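/- **Theorem.** Let $s,f$ be the transformations of $\mathbb Z$, acting on the right, given by $x^s=x-1$ if $x$ is odd and $x^s=x+1$ if $x$ is even; $x^f=x-2^n-1$ if $x\equiv 3\cdot 2^n \pmod{2^{n+2}}$ for some $n\ge 0$, $x^f=x+3\cdot 2^n-1$ if $x\equiv 2^n\pmod{2^{n+2}}$ for some $n\ge0$, and $0^f=-1$. Let $F$ be the semigroup generated by $s$ and $f$ under composition (it contains the identity $e=s^2$, which is represented by the empty word). For $g\in F$ let $\|g\|$ be the least $\ell\ge 0$ such that $g$ is a product of $\ell$ generators from $\{s,f\}$. Define words over $\{s,f\}$ by $f_1=s$, $f_2=f$, $f_n=f_{n-2}f_{n-1}$ for $n\ge3$, and let $\Phi_1=\Phi_2=1$, $\Phi_n=\Phi_{n-2}+\Phi_{n-1}$ for $n\ge 3$. Every element $g$ of $F$ admits a unique representation as a word of the form $$w_g=s^{\epsilon}f_{i_1}f_{i_2}\cdots f_{i_m}\cdots f_{i_n}$$ with $n\ge 0$, $\epsilon\in\{0,1\}$ and, if $n\ge 1$, indices satisfying, for some $1\le m\le n$, $$3\le i_1,\quad i_1+1<i_2,\ \dots,\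 i_{m-1}+1<i_m,\quad i_m>i_{m+1}>\cdots>i_n\ge 1 .$$ Spell $w_g$ out as a word over $\{s,f\}$. If $n=0$, or $i_1$ is even, or $\epsilon=0$, then $w_g$ is the unique minimal-length word over $\{s,f\}$ representing $g$. If $n\ge1$, $i_1$ is odd and $\epsilon=1$, then $w_g$ begins with $s^2$, and cancelling this initial $s^2$ gives the unique minimal-length word representing $g$. The length of $g$ is $$\|g\|=(-1)^{i_1}\epsilon+\Phi_{i_1}+\cdots+\Phi_{i_n}\quad\text{if } n\ge1,\qquad \|g\|=\epsilon\quad\text{if } n=0 .$$ -/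

import Mathlib

namespace FibSemigroup

/-- The involution `x ↦ x - 1` for odd `x`, `x ↦ x + 1` for even `x`. -/
def sMap (x : ℤ) : ℤ := if Odd x then x - 1 else x + 1

open Classical in
/-- The map `x ↦ x - 2^n - 1` if `x ≡ 3·2^n (mod 2^(n+2))`, `x ↦ x + 3·2^n - 1` if
`x ≡ 2^n (mod 2^(n+2))`, and `0 ↦ -1`. For `x ≠ 0` exactly one of the two congruences holds, for
exactly one `n`; see `fMap_of_three`, `fMap_of_one`, `fMap_zero`. -/
noncomputable def fMap (x : ℤ) : ℤ :=
  if h : ∃ n : ℕ, x ≡ 3 * 2 ^ n [ZMOD 2 ^ (n + 2)] then x - 2 ^ (Nat.find h) - 1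
  else if h : ∃ n : ℕ, x ≡ 2 ^ n [ZMOD 2 ^ (n + 2)] then x + 3 * 2 ^ (Nat.find h) - 1
  else -1

theorem exists_mul_of_modEq {x c : ℤ} {n : ℕ} (h : x ≡ c * 2 ^ n [ZMOD 2 ^ (n + 2)]) :
    ∃ k : ℤ, x = (4 * k + c) * 2 ^ n := by
  obtain ⟨k, hk⟩ := h.symm.dvd
  refine ⟨k, ?_⟩
  have : (2 : ℤ) ^ (n + 2) = 4 * 2 ^ n := by ring
  rw [this] at hk
  linarith

theorem odd_mul_two_pow_inj {a b : ℤ} {m n : ℕ} (ha : Odd a) (hb : Odd b)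
    (h : a * 2 ^ m = b * 2 ^ n) : m = n ∧ a = b := by
  have key : ∀ {a b : ℤ} {m n : ℕ}, Odd a → a * 2 ^ m = b * 2 ^ n → n ≤ m := by
    intro a b m n ha h
    by_contra! hlt
    obtain ⟨d, rfl⟩ := Nat.exists_eq_add_of_lt hlt
    have h2 : (2 : ℤ) ^ m ≠ 0 := by positivity
    have h3 : a = b * 2 ^ d * 2 := by
      apply mul_right_cancel₀ h2
      rw [h]
      ring
    rw [h3] at ha
    exact (Int.not_odd_iff_even.2 (even_two.mul_left _)) ha
  have hmn : m = n := le_antisymm (key hb h.symm) (key ha h)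
  subst hmn
  exact ⟨rfl, mul_right_cancel₀ (by positivity) h⟩

theorem fMap_of_three {x : ℤ} {n : ℕ} (h : x ≡ 3 * 2 ^ n [ZMOD 2 ^ (n + 2)]) :
    fMap x = x - 2 ^ n - 1 := by
  classical
  have hex : ∃ n : ℕ, x ≡ 3 * 2 ^ n [ZMOD 2 ^ (n + 2)] := ⟨n, h⟩
  obtain ⟨k, hk⟩ := exists_mul_of_modEq h
  obtain ⟨l, hl⟩ := exists_mul_of_modEq (Nat.find_spec hex)
  have := (odd_mul_two_pow_inj (a := 4 * k + 3) (b := 4 * l + 3) ⟨2 * k + 1, by ring⟩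
    ⟨2 * l + 1, by ring⟩ (hk.symm.trans hl)).1
  rw [fMap, dif_pos hex, ← this]

theorem fMap_of_one {x : ℤ} {n : ℕ} (h : x ≡ 2 ^ n [ZMOD 2 ^ (n + 2)]) :
    fMap x = x + 3 * 2 ^ n - 1 := by
  classical
  have hex : ∃ n : ℕ, x ≡ 2 ^ n [ZMOD 2 ^ (n + 2)] := ⟨n, h⟩
  obtain ⟨k, hk⟩ := exists_mul_of_modEq (c := 1) (by simpa using h)
  have hno : ¬ ∃ n : ℕ, x ≡ 3 * 2 ^ n [ZMOD 2 ^ (n + 2)] := by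
    rintro ⟨m, hm⟩
    obtain ⟨l, hl⟩ := exists_mul_of_modEq hm
    have := (odd_mul_two_pow_inj (a := 4 * k + 1) (b := 4 * l + 3) ⟨2 * k, by ring⟩
      ⟨2 * l + 1, by ring⟩ (hk.symm.trans hl)).2
    omega
  obtain ⟨l, hl⟩ := exists_mul_of_modEq (c := 1) (by simpa using Nat.find_spec hex)
  have := (odd_mul_two_pow_inj (a := 4 * k + 1) (b := 4 * l + 1) ⟨2 * k, by ring⟩
    ⟨2 * l, by ring⟩ (hk.symm.trans hl)).1
  rw [fMap, dif_neg hno, dif_pos hex, ← this]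

theorem fMap_zero : fMap 0 = -1 := by
  have h3 : ¬ ∃ n : ℕ, (0 : ℤ) ≡ 3 * 2 ^ n [ZMOD 2 ^ (n + 2)] := by
    rintro ⟨m, hm⟩
    obtain ⟨l, hl⟩ := exists_mul_of_modEq hm
    have h2 : (2 : ℤ) ^ m ≠ 0 := by positivity
    have := (mul_eq_zero.1 hl.symm).resolve_right h2
    omega
  have h1 : ¬ ∃ n : ℕ, (0 : ℤ) ≡ 2 ^ n [ZMOD 2 ^ (n + 2)] := by
    rintro ⟨m, hm⟩
    obtain ⟨l, hl⟩ := exists_mul_of_modEq (c := 1) (by simpa using hm)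
    have h2 : (2 : ℤ) ^ m ≠ 0 := by positivity
    have := (mul_eq_zero.1 hl.symm).resolve_right h2
    omega
  rw [fMap, dif_neg h3, dif_neg h1]

/-- The monoid of all transformations of `ℤ`, acting on the right: `g * h` is `g` followed
by `h`. -/
abbrev Transf : Type := (Function.End ℤ)ᵐᵒᵖ

/-- The image `x^g` of the integer `x` under the transformation `g`. -/
def app (x : ℤ) (g : Transf) : ℤ := (g.unop : ℤ → ℤ) x

theorem app_mul (x : ℤ) (g h : Transf) : app x (g * h) = app (app x g) h := rfl

/-- The transformation `s`. -/
def sT : Transf := MulOpposite.op sMap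

/-- The transformation `f`. -/
noncomputable def fT : Transf := MulOpposite.op fMap

theorem app_sT (x : ℤ) : app x sT = sMap x := rfl

theorem app_fT (x : ℤ) : app x fT = fMap x := rfl

/-- The semigroup `F` generated by `s` and `f`. -/
noncomputable def F : Subsemigroup Transf := Subsemigroup.closure {sT, fT}

/-- The two-letter alphabet `{s, f}`. -/
inductive Letter : Type
  | s : Letter
  | f : Letter

/-- The generator named by a letter. -/
noncomputable def gen : Letter → Transf
  | Letter.s => sT
  | Letter.f => fT

/-- The transformation represented by a word over `{s, f}`; the empty word represents the
identity. -/
noncomputable def eval (w : List Letter) : Transf := (w.map gen).prod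

theorem eval_append (u v : List Letter) : eval (u ++ v) = eval u * eval v := by
  simp [eval]

/-- The norm `‖g‖`: the least length of a word over `{s, f}` that represents `g`. -/
noncomputable def norm (g : Transf) : ℕ :=
  sInf {l : ℕ | ∃ w : List Letter, eval w = g ∧ w.length = l}

/-- The Fibonacci words `f_1 = s`, `f_2 = f`, `f_n = f_{n-2} f_{n-1}` for `n ≥ 3`
(the value at `0` is never used). -/
def fibWord : ℕ → List Letter
  | 0 => []
  | 1 => [Letter.s]
  | 2 => [Letter.f]
  | n + 3 => fibWord (n + 1) ++ fibWord (n + 2)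

theorem eval_fibWord_one : eval (fibWord 1) = sT := by simp [eval, fibWord, gen]

theorem eval_fibWord_two : eval (fibWord 2) = fT := by simp [eval, fibWord, gen]

theorem eval_fibWord_add_three (n : ℕ) :
    eval (fibWord (n + 3)) = eval (fibWord (n + 1)) * eval (fibWord (n + 2)) := by
  rw [fibWord, eval_append]

/-- The condition on the index sequence `(i_1, …, i_n)`: either `n = 0`, or there is a position
`m` with `3 ≤ i_1`, `i_1 + 1 < i_2`, …, `i_{m-1} + 1 < i_m`, `i_m > i_{m+1} > ⋯ > i_n ≥ 1`.
Here `I = a ++ M :: b` with `M = i_m`. -/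
def IsAdmissible (I : List ℕ) : Prop :=
  I = [] ∨ ∃ (a : List ℕ) (M : ℕ) (b : List ℕ), I = a ++ M :: b ∧
    (∀ i ∈ I.head?, 3 ≤ i) ∧
    (a ++ [M]).IsChain (fun i j => i + 1 < j) ∧
    (M :: b).IsChain (fun i j => i > j) ∧
    ∀ i ∈ I, 1 ≤ i

/-- The word `s^ε f_{i_1} ⋯ f_{i_n}`, spelled out over `{s, f}`. -/
def nfWord (ε : Fin 2) (I : List ℕ) : List Letter :=
  List.replicate (ε : ℕ) Letter.s ++ I.flatMap fibWord

theorem eval_nfWord (ε : Fin 2) (I : List ℕ) :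
    eval (nfWord ε I) = sT ^ (ε : ℕ) * (I.map fun i => eval (fibWord i)).prod := by
  rw [nfWord, eval_append]
  congr 1
  · simp [eval, gen]
  · induction I with
    | nil => simp [eval]
    | cons i I ih => rw [List.flatMap_cons, eval_append, ih, List.map_cons, List.prod_cons]

/-- The word `w` represents `g`, and every other word that represents `g` is strictly longer. -/
def IsUniqueMinimal (w : List Letter) (g : Transf) : Prop :=
  eval w = g ∧ ∀ u : List Letter, eval u = g → u ≠ w → w.length < u.length

end FibSemigroup

namespace FibSemigroup

theorem sMap_two_mul (y : ℤ) : sMap (2 * y) = 2 * y + 1 := by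
  rw [sMap, if_neg (by simp)]

theorem sMap_two_mul_add_one (y : ℤ) : sMap (2 * y + 1) = 2 * y := by
  rw [sMap, if_pos (odd_two_mul_add_one y)]
  ring

theorem exists_eq_odd_mul_two_pow {y : ℤ} (hy : y ≠ 0) :
    ∃ (n : ℕ) (k : ℤ), y = (4 * k + 1) * 2 ^ n ∨ y = (4 * k + 3) * 2 ^ n := by
  have hfin : FiniteMultiplicity (2 : ℤ) y :=
    Int.finiteMultiplicity_iff.2 ⟨by decide, hy⟩
  obtain ⟨c, hc, hd⟩ := hfin.exists_eq_pow_mul_and_not_dvd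
  refine ⟨multiplicity 2 y, c / 4, ?_⟩
  have : c = 4 * (c / 4) + 1 ∨ c = 4 * (c / 4) + 3 := by omega
  rcases this with h | h
  · left; rw [← h, mul_comm]; exact hc
  · right; rw [← h, mul_comm]; exact hc

theorem fMap_three_mul (n : ℕ) (k : ℤ) :
    fMap ((4 * k + 3) * 2 ^ n) = (4 * k + 3) * 2 ^ n - 2 ^ n - 1 :=
  fMap_of_three (Int.modEq_iff_dvd.2 ⟨-k, by ring⟩)

theorem fMap_one_mul (n : ℕ) (k : ℤ) :
    fMap ((4 * k + 1) * 2 ^ n) = (4 * k + 1) * 2 ^ n + 3 * 2 ^ n - 1 :=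
  fMap_of_one (Int.modEq_iff_dvd.2 ⟨-k, by ring⟩)

theorem fMap_two_mul (y : ℤ) : fMap (2 * y) = 2 * fMap y + 1 := by
  rcases eq_or_ne y 0 with rfl | hy
  · simp [fMap_zero]
  · obtain ⟨n, k, rfl | rfl⟩ := exists_eq_odd_mul_two_pow hy
    · rw [show 2 * ((4 * k + 1) * 2 ^ n) = (4 * k + 1) * 2 ^ (n + 1) by ring,
        fMap_one_mul, fMap_one_mul]
      ring
    · rw [show 2 * ((4 * k + 3) * 2 ^ n) = (4 * k + 3) * 2 ^ (n + 1) by ring,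
        fMap_three_mul, fMap_three_mul]
      ring

theorem fMap_two_mul_add_one (y : ℤ) : fMap (2 * y + 1) = 2 * sMap y + 1 := by
  rcases Int.even_or_odd' y with ⟨k, rfl | rfl⟩
  · have := fMap_one_mul 0 k
    rw [sMap_two_mul, show 2 * (2 * k) + 1 = (4 * k + 1) * 2 ^ 0 by ring, this]
    ring
  · have := fMap_three_mul 0 k
    rw [sMap_two_mul_add_one, show 2 * (2 * k + 1) + 1 = (4 * k + 3) * 2 ^ 0 by ring, this]
    ring

theorem transf_ext {g h : Transf} (H : ∀ x, app x g = app x h) : g = h :=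
  MulOpposite.unop_injective (funext H)

theorem sT_mul_self : sT * sT = 1 := by
  apply transf_ext
  intro x
  rw [app_mul, app_sT, app_sT]
  rcases Int.even_or_odd' x with ⟨k, rfl | rfl⟩
  · rw [sMap_two_mul, sMap_two_mul_add_one]; rfl
  · rw [sMap_two_mul_add_one, sMap_two_mul]; rfl

theorem sT_mul_cancel (g : Transf) : sT * (sT * g) = g := by
  rw [← mul_assoc, sT_mul_self, one_mul]

theorem sT_mul_left_inj {g h : Transf} (H : sT * g = sT * h) : g = h := by
  rw [← sT_mul_cancel g, H, sT_mul_cancel]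

theorem mul_sT_right_inj {g h : Transf} (H : g * sT = h * sT) : g = h := by
  rw [← mul_one g, ← sT_mul_self, ← mul_assoc, H, mul_assoc, sT_mul_self, mul_one]

/-- All values of `g` are odd, and `g` acts on halves as `a` at even and as `b` at odd integers. -/
def Sec (g a b : Transf) : Prop :=
  ∀ y, app (2 * y) g = 2 * app y a + 1 ∧ app (2 * y + 1) g = 2 * app y b + 1

theorem Sec.mul {g a b h c d : Transf} (hg : Sec g a b) (hh : Sec h c d) :
    Sec (g * h) (a * d) (b * d) := by
  intro y
  simp only [app_mul, (hg y).1, (hg y).2, (hh _).2, and_self]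

theorem Sec.sT_mul {g a b : Transf} (hg : Sec g a b) : Sec (sT * g) b a := by
  intro y
  simp only [app_mul, app_sT, sMap_two_mul, sMap_two_mul_add_one, (hg y).1, (hg y).2, and_self]

theorem Sec.ext {g h a b : Transf} (hg : Sec g a b) (hh : Sec h a b) : g = h := by
  apply transf_ext
  intro x
  rcases Int.even_or_odd' x with ⟨k, rfl | rfl⟩
  · rw [(hg k).1, (hh k).1]
  · rw [(hg k).2, (hh k).2]

theorem Sec.inj {g a b c d : Transf} (hg : Sec g a b) (hh : Sec g c d) : a = c ∧ b = d := by
  constructor <;> apply transf_ext <;> intro y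
  · have := (hg y).1.symm.trans (hh y).1
    omega
  · have := (hg y).2.symm.trans (hh y).2
    omega

theorem Sec.odd {g a b : Transf} (hg : Sec g a b) (x : ℤ) : Odd (app x g) := by
  rcases Int.even_or_odd' x with ⟨k, rfl | rfl⟩
  · rw [(hg k).1]; exact odd_two_mul_add_one _
  · rw [(hg k).2]; exact odd_two_mul_add_one _

theorem sec_fT : Sec fT fT sT := by
  intro y
  simp only [app_fT, app_sT, fMap_two_mul, fMap_two_mul_add_one, and_self]

/-- The transformation represented by the Fibonacci word `f_i`. -/
noncomputable def phi (i : ℕ) : Transf := eval (fibWord i)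

theorem phi_one : phi 1 = sT := eval_fibWord_one

theorem phi_two : phi 2 = fT := eval_fibWord_two

theorem phi_add_three (n : ℕ) : phi (n + 3) = phi (n + 1) * phi (n + 2) :=
  eval_fibWord_add_three n

theorem phi_mul_self (n : ℕ) : phi (n + 3) * phi (n + 3) = phi (n + 1) * phi (n + 4) := by
  rw [phi_add_three (n + 1), ← mul_assoc, ← phi_add_three]

/-- The action of `f_n` on the halves of even integers. -/
noncomputable def alpha : ℕ → Transf
  | 0 => 1
  | 1 => 1
  | 2 => fT
  | 3 => sT
  | n + 4 => alpha (n + 2) * phi (n + 2)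

theorem sec_phi_two : Sec (phi 2) (alpha 2) (phi 1) := by
  rw [phi_two, phi_one]; exact sec_fT

theorem sec_phi_three : Sec (phi 3) (alpha 3) (phi 2) := by
  rw [phi_add_three, phi_one, phi_two]; exact sec_fT.sT_mul

theorem sec_phi (n : ℕ) : Sec (phi (n + 2)) (alpha (n + 2)) (phi (n + 1)) ∧
    Sec (phi (n + 3)) (alpha (n + 3)) (phi (n + 2)) := by
  induction n with
  | zero => exact ⟨sec_phi_two, sec_phi_three⟩
  | succ n ih =>
    refine ⟨ih.2, ?_⟩
    have := ih.1.mul ih.2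
    rwa [← phi_add_three, ← phi_add_three] at this

theorem fT_cube : fT * (fT * fT) = fT := by
  refine Sec.ext (sec_fT.mul (sec_fT.mul sec_fT)) ?_
  rw [sT_mul_self, mul_one, mul_one]
  exact sec_fT

theorem fT_cube' (g : Transf) : fT * (fT * (fT * g)) = fT * g := by
  rw [← mul_assoc fT fT g, ← mul_assoc, fT_cube]

theorem phi_three : phi 3 = sT * fT := by rw [phi_add_three, phi_one, phi_two]

theorem phi_four : phi 4 = fT * (sT * fT) := by
  rw [phi_add_three 1, phi_two, phi_three]

theorem alpha_four : alpha 4 = fT * fT := by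
  rw [alpha, alpha, phi_two]

theorem alpha_five : alpha 5 = fT := by
  rw [alpha, alpha, phi_three, sT_mul_cancel]

theorem alpha_six : alpha 6 = phi 4 := by
  rw [alpha, alpha_four, phi_four, mul_assoc, fT_cube']

theorem phi_three_two_two : phi 3 * (phi 2 * phi 2) = phi 3 := by
  rw [phi_three, phi_two, mul_assoc, fT_cube]

theorem phi_four_three_three : phi 4 * (phi 3 * phi 3) = phi 4 := by
  refine Sec.ext ((sec_phi 2).1.mul (sec_phi_three.mul sec_phi_three)) ?_
  have : phi 3 * (phi 2 * phi 2) = phi 3 := phi_three_two_two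
  rw [this, alpha_four, phi_two, mul_assoc, fT_cube', ← alpha_four]
  exact (sec_phi 2).1

/-- The even section of `relPrefix`. -/
noncomputable def relPrefixSec : ℕ → Transf
  | 0 => phi 4
  | 1 => phi 2 * phi 5
  | n + 2 => relPrefixSec n * phi (n + 6)

/-- The prefix acquired by `f_{n+5} f_{n+4} f_{n+4}` when its last factor is removed. -/
def relPrefix : ℕ → List Letter
  | 0 => []
  | 1 => [Letter.f]
  | n + 2 => relPrefix n ++ fibWord (n + 5)

theorem eval_relPrefix_add_two (n : ℕ) :
    eval (relPrefix (n + 2)) = eval (relPrefix n) * phi (n + 5) := by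
  rw [relPrefix, eval_append, phi]

theorem alpha_mul_phi (n : ℕ) :
    alpha (n + 7) * phi (n + 5) = relPrefixSec n * phi (n + 6) ∧
    alpha (n + 8) * phi (n + 6) = relPrefixSec (n + 1) * phi (n + 7) := by
  induction n with
  | zero =>
    constructor
    · rw [alpha, alpha_five, mul_assoc, phi_mul_self 2, ← mul_assoc, relPrefixSec, phi_four,
        phi_three]
    · rw [alpha, alpha_six, mul_assoc, phi_mul_self 3, ← mul_assoc, phi_mul_self 1, relPrefixSec]
  | succ n ih =>
    refine ⟨ih.2, ?_⟩
    rw [alpha, mul_assoc, phi_mul_self (n + 4), ← mul_assoc, ih.1, relPrefixSec]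

/-- `s` for even `n`, the identity for odd `n`. -/
noncomputable def sgn (n : ℕ) : Transf := if Even n then sT else 1

theorem sgn_zero : sgn 0 = sT := by simp [sgn]
theorem sgn_one : sgn 1 = 1 := by simp [sgn]
theorem sgn_add_two (n : ℕ) : sgn (n + 2) = sgn n := by simp [sgn, Nat.even_add]

theorem sec_relPrefix (n : ℕ) :
    Sec (sgn n * eval (relPrefix (n + 2))) (relPrefixSec n) (sgn (n + 1) * eval (relPrefix (n + 1)))
    ∧ Sec (sgn (n + 1) * eval (relPrefix (n + 3))) (relPrefixSec (n + 1))
      (sgn n * eval (relPrefix (n + 2))) := by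
  induction n with
  | zero =>
    have h0 : eval (relPrefix 0) = 1 := by simp [eval, relPrefix]
    have h1 : eval (relPrefix 1) = fT := by simp [eval, relPrefix, gen]
    rw [eval_relPrefix_add_two, eval_relPrefix_add_two, sgn_zero, sgn_one, h0, h1, one_mul,
      one_mul, one_mul, relPrefixSec, relPrefixSec, phi_two]
    constructor
    · rw [← alpha_five]
      exact (sec_phi 3).1.sT_mul
    · exact sec_fT.mul (sec_phi 4).1
  | succ n ih =>
    refine ⟨by rw [sgn_add_two]; exact ih.2, ?_⟩
    have h2 : eval (relPrefix (n + 1 + 3)) = eval (relPrefix (n + 2)) * phi (n + 7) :=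
      eval_relPrefix_add_two (n + 2)
    have h1 : eval (relPrefix (n + 1 + 2)) = eval (relPrefix (n + 1)) * phi (n + 6) :=
      eval_relPrefix_add_two (n + 1)
    rw [h1, h2, sgn_add_two, ← mul_assoc, relPrefixSec, ← mul_assoc]
    exact ih.1.mul (sec_phi (n + 5)).1

theorem phi_relation (n : ℕ) :
    phi (n + 5) * (phi (n + 4) * phi (n + 4)) =
      sgn n * eval (relPrefix n) * (phi (n + 5) * phi (n + 4)) := by
  induction n with
  | zero =>
    have h0 : eval (relPrefix 0) = 1 := by simp [eval, relPrefix]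
    rw [h0, sgn_zero, mul_one]
    refine Sec.ext ((sec_phi 3).1.mul ((sec_phi 2).1.mul (sec_phi 2).1)) ?_
    have h := ((sec_phi 3).1.mul (sec_phi 2).1).sT_mul
    convert h using 1
    · rw [alpha_five, phi_four, phi_three]; simp only [mul_assoc]
    · exact phi_four_three_three.trans (by rw [alpha_five, phi_four, phi_three])
  | succ n ih =>
    refine Sec.ext ((sec_phi (n + 4)).1.mul ((sec_phi (n + 3)).1.mul (sec_phi (n + 3)).1)) ?_
    have hlast := (sec_phi (n + 4)).1.mul (sec_phi (n + 3)).1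
    rcases n with _ | n
    · have h1 : eval (relPrefix 1) = fT := by simp [eval, relPrefix, gen]
      have h0 : eval (relPrefix 0) = 1 := by simp [eval, relPrefix]
      rw [h0, sgn_zero, mul_one] at ih
      rw [h1, sgn_one, one_mul]
      convert sec_fT.mul hlast using 1
      rw [alpha_six, ← mul_assoc, phi_mul_self 1, phi_add_three 2, phi_two]
      simp only [mul_assoc]
    · have h := (sec_relPrefix n).1
      have h2 := h.mul hlast
      rw [sgn_add_two]
      convert h2 using 1
      rw [← mul_assoc, (alpha_mul_phi n).1]
      simp only [mul_assoc]

theorem eval_nil : eval [] = 1 := by simp [eval]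
theorem eval_s : eval [Letter.s] = sT := by simp [eval, gen]
theorem eval_f : eval [Letter.f] = fT := by simp [eval, gen]
theorem eval_cons_s (w : List Letter) : eval (Letter.s :: w) = sT * eval w := by simp [eval, gen]

theorem length_fibWord (n : ℕ) : (fibWord n).length = Nat.fib n := by
  induction n using Nat.strong_induction_on with
  | _ n ih =>
    match n with
    | 0 => rfl
    | 1 => rfl
    | 2 => rfl
    | n + 3 =>
      rw [fibWord, List.length_append, ih _ (by omega), ih _ (by omega), ← Nat.fib_add_two]

/-- Multiplication by `s` on the left, with cancellation. -/
def sCons : List Letter → List Letter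
  | [] => [Letter.s]
  | Letter.s :: w => w
  | Letter.f :: w => Letter.s :: Letter.f :: w

theorem eval_sCons (w : List Letter) : eval (sCons w) = sT * eval w := by
  match w with
  | [] => rw [sCons, eval_s, eval_nil, mul_one]
  | Letter.s :: w => rw [sCons, eval_cons_s, sT_mul_cancel]
  | Letter.f :: w => rw [sCons, eval_cons_s]

theorem sCons_append {w : List Letter} (hw : w ≠ []) (v : List Letter) :
    sCons (w ++ v) = sCons w ++ v := by
  match w with
  | [] => exact absurd rfl hw
  | Letter.s :: w => rfl
  | Letter.f :: w => rfl

theorem head?_fibWord (n : ℕ) :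
    (fibWord (2 * n + 1)).head? = some Letter.s ∧ (fibWord (2 * n + 2)).head? = some Letter.f := by
  induction n with
  | zero => exact ⟨rfl, rfl⟩
  | succ n ih =>
    rw [show 2 * (n + 1) + 1 = 2 * n + 3 by ring, show 2 * (n + 1) + 2 = (2 * n + 1) + 3 by ring,
      fibWord, fibWord, List.head?_append, List.head?_append, ih.1, ih.2]
    exact ⟨rfl, rfl⟩

theorem fibWord_odd {i : ℕ} (hi : Odd i) : ∃ w, fibWord i = Letter.s :: w := by
  obtain ⟨n, rfl⟩ := hi
  have h := (head?_fibWord n).1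
  cases h' : fibWord (2 * n + 1) with
  | nil => simp [h'] at h
  | cons a w => simp_all

theorem fibWord_even {i : ℕ} (hi : Even i) (h0 : 0 < i) : ∃ w, fibWord i = Letter.f :: w := by
  obtain ⟨n, hn⟩ := hi
  obtain ⟨m, rfl⟩ : ∃ m, i = 2 * m + 2 := ⟨n - 1, by omega⟩
  have h := (head?_fibWord m).2
  cases h' : fibWord (2 * m + 2) with
  | nil => simp [h'] at h
  | cons a w => simp_all

theorem fibWord_ne_nil {i : ℕ} (h0 : 0 < i) : fibWord i ≠ [] := by
  rcases Nat.even_or_odd i with h | h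
  · obtain ⟨w, hw⟩ := fibWord_even h h0
    simp [hw]
  · obtain ⟨w, hw⟩ := fibWord_odd h
    simp [hw]

/-- Strictly decreasing sequences with entries in `[lo, m)`. -/
def Dec (lo : ℕ) : ℕ → List ℕ → Prop
  | _, [] => True
  | m, i :: J => lo ≤ i ∧ i < m ∧ Dec lo i J

/-- Nonempty sequences that increase in steps of at least two from a value `≥ k` to a maximum and
then decrease strictly, staying `≥ lo`. -/
def Uni (lo : ℕ) : ℕ → List ℕ → Prop
  | _, [] => False
  | k, i :: J => k ≤ i ∧ (Dec lo i J ∨ Uni lo (i + 2) J)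

/-- The concatenation of the Fibonacci words with indices in `I`. -/
abbrev fibWords (I : List ℕ) : List Letter := I.flatMap fibWord

theorem Uni.mono {lo k k' : ℕ} {I : List ℕ} (h : Uni lo k I) (hk : k' ≤ k) : Uni lo k' I := by
  match I, h with
  | i :: J, ⟨h1, h2⟩ => exact ⟨hk.trans h1, h2⟩

theorem Dec.mono {lo m m' : ℕ} {I : List ℕ} (h : Dec lo m I) (hm : m ≤ m') : Dec lo m' I := by
  match I, h with
  | [], _ => trivial
  | i :: J, ⟨h1, h2, h3⟩ => exact ⟨h1, h2.trans_le hm, h3⟩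

theorem Uni.fibWords_ne_nil {lo k : ℕ} {I : List ℕ} (h : Uni lo k I) (hk : 0 < k) :
    fibWords I ≠ [] := by
  match I, h with
  | i :: J, ⟨h1, h2⟩ =>
    have := fibWord_ne_nil (hk.trans_le h1)
    simp [this]

theorem fibWord_add_three' {i j k : ℕ} (hj : j = i + 1) (hk : k = i + 2) (hi : 1 ≤ i) :
    fibWord k = fibWord i ++ fibWord j := by
  subst hj hk
  obtain ⟨n, rfl⟩ := Nat.exists_eq_add_of_le' hi
  rw [fibWord]

theorem fibWord_append_self {i : ℕ} (hi : 3 ≤ i) :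
    fibWord i ++ fibWord i = fibWord (i - 2) ++ fibWord (i + 1) := by
  obtain ⟨n, rfl⟩ := Nat.exists_eq_add_of_le' hi
  rw [fibWord_add_three' (i := n + 1) rfl rfl (by omega),
    fibWord_add_three' (i := n + 2) (j := n + 3) (k := n + 4) rfl rfl (by omega),
    fibWord_add_three' (i := n + 1) (j := n + 2) (k := n + 3) rfl rfl (by omega)]
  simp

theorem fibWord_suffix {i m : ℕ} (hi : 1 ≤ i) (hm : i < m) :
    ∃ P, fibWord m = P ++ fibWord (i + 1) := by
  induction m, hm using Nat.le_induction with
  | base => exact ⟨[], rfl⟩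
  | succ m hm ih =>
    obtain ⟨P, hP⟩ := ih
    refine ⟨fibWord (m - 1) ++ P, ?_⟩
    rw [fibWord_add_three' (i := m - 1) (j := m) (by omega) (by omega) (by omega), hP,
      List.append_assoc]

/-- The word `w` ends with `f_{i+1} f_i f_i` for some `i ≥ 2`. -/
def EndsBad (w : List Letter) : Prop :=
  ∃ P i, 2 ≤ i ∧ w = P ++ (fibWord (i + 1) ++ fibWord i ++ fibWord i)

theorem EndsBad.append {w : List Letter} (h : EndsBad w) (v : List Letter) : EndsBad (v ++ w) := by
  obtain ⟨P, i, hi, rfl⟩ := h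
  exact ⟨v ++ P, i, hi, by simp⟩

theorem EndsBad.of_fibWord {m i : ℕ} (hi : 2 ≤ i) (hm : i < m) :
    EndsBad (fibWord m ++ (fibWord i ++ fibWord i)) := by
  obtain ⟨P, hP⟩ := fibWord_suffix (by omega) hm
  exact ⟨P, i, hi, by rw [hP]; simp⟩

theorem Dec.append_f {m : ℕ} {J : List ℕ} (hm : 1 ≤ m) (h : Dec 1 m J) :
    (∃ J', Dec 1 m J' ∧ fibWords J' = fibWords J ++ [Letter.f]) ∨
    EndsBad (fibWord m ++ (fibWords J ++ [Letter.f])) ∨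
    (∃ j, 2 ≤ j ∧ (j = m ∨ j = m + 1) ∧ fibWords J ++ [Letter.f] = fibWord j) := by
  induction J generalizing m with
  | nil =>
    rcases lt_trichotomy m 2 with h2 | rfl | h2
    · exact .inr (.inr ⟨2, le_rfl, .inr (by omega), rfl⟩)
    · exact .inr (.inr ⟨2, le_rfl, .inl rfl, rfl⟩)
    · exact .inl ⟨[2], ⟨by omega, h2, trivial⟩, rfl⟩
  | cons i J ih =>
    obtain ⟨h1, h2, h3⟩ := h
    rcases ih h1 h3 with ⟨J', hJ', e⟩ | hb | ⟨j, hj2, rfl | rfl, e⟩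
    · exact .inl ⟨i :: J', ⟨h1, h2, hJ'⟩, by simp [e]⟩
    · refine .inr (.inl ?_)
      have := hb.append (fibWord m)
      simpa using this
    · refine .inr (.inl ?_)
      have := EndsBad.of_fibWord hj2 h2
      simpa [← e] using this
    · have e' : fibWords (i :: J) ++ [Letter.f] = fibWord (i + 2) := by
        rw [fibWord_add_three' (i := i) rfl rfl h1, ← e]
        simp
      rcases lt_or_ge (i + 2) m with hlt | hge
      · exact .inl ⟨[i + 2], ⟨by omega, hlt, trivial⟩, by rw [e']; simp⟩
      · exact .inr (.inr ⟨i + 2, by omega, by omega, e'⟩)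

theorem fibWords_nil : fibWords [] = [] := rfl

theorem fibWords_cons (i : ℕ) (I : List ℕ) : fibWords (i :: I) = fibWord i ++ fibWords I :=
  List.flatMap_cons

/-- The possible shapes of a word spelled by an index sequence bounded below by `k`, after a letter
`f` has been appended. -/
def Spelled (k : ℕ) (w : List Letter) : Prop :=
  (∃ I, Uni 1 k I ∧ w = fibWords I) ∨ EndsBad w ∨
  (∃ I, Uni 1 (k + 1) I ∧ w = fibWord (k - 2) ++ fibWords I) ∨
  (∃ I, Uni 1 (k + 2) I ∧ w = fibWord (k - 1) ++ fibWords I)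

theorem Spelled.of_square {k i : ℕ} {L : List ℕ} (hk : 3 ≤ k) (hi : k ≤ i)
    (hU : Dec 1 (i + 1) L ∨ Uni 1 (i + 3) L) :
    Spelled k (fibWord i ++ (fibWord i ++ fibWords L)) := by
  rw [← List.append_assoc, fibWord_append_self (hk.trans hi), List.append_assoc, ← fibWords_cons]
  by_cases h1 : k ≤ i - 2
  · exact .inl ⟨(i - 2) :: (i + 1) :: L, ⟨h1, .inr ⟨by omega, hU⟩⟩, by simp only [fibWords_cons]⟩
  · rcases Nat.eq_or_lt_of_le hi with rfl | hlt
    · exact .inr (.inr (.inl ⟨(k + 1) :: L, ⟨le_rfl, hU⟩, rfl⟩))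
    · obtain rfl : i = k + 1 := by omega
      exact .inr (.inr (.inr ⟨(k + 2) :: L, ⟨le_rfl, hU⟩, rfl⟩))

theorem Spelled.of_step {k i : ℕ} {L : List ℕ} (hk : 3 ≤ k) (hi : k ≤ i)
    (hU : Dec 1 (i + 2) L ∨ Uni 1 (i + 4) L) :
    Spelled k (fibWord i ++ (fibWord (i + 1) ++ fibWords L)) := by
  refine .inl ⟨(i + 2) :: L, ⟨by omega, hU⟩, ?_⟩
  rw [fibWords_cons, fibWord_add_three' (i := i) rfl rfl (by omega), List.append_assoc]

theorem Uni.append_f {k : ℕ} {I : List ℕ} (hk : 3 ≤ k) (h : Uni 1 k I) :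
    Spelled k (fibWords I ++ [Letter.f]) := by
  induction I generalizing k with
  | nil => exact h.elim
  | cons i J ih =>
    obtain ⟨h1, h2⟩ := h
    rw [fibWords_cons, List.append_assoc]
    rcases h2 with h2 | h2
    · rcases h2.append_f (by omega) with ⟨J', hJ', e⟩ | hb | ⟨j, hj2, rfl | rfl, e⟩
      · exact .inl ⟨i :: J', ⟨h1, .inl hJ'⟩, by rw [← e, fibWords_cons]⟩
      · exact .inr (.inl hb)
      · have := Spelled.of_square (L := []) hk h1 (.inl trivial)
        rwa [e, ← List.append_nil (fibWord j), List.append_assoc]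
      · have := Spelled.of_step (L := []) hk h1 (.inl trivial)
        rwa [fibWords_nil, List.append_nil, ← e] at this
    · rcases ih (by omega) h2 with ⟨I', hI', e⟩ | hb | ⟨I', hI', e⟩ | ⟨I', hI', e⟩
      · exact .inl ⟨i :: I', ⟨h1, .inr hI'⟩, by rw [e, fibWords_cons]⟩
      · exact .inr (.inl (hb.append _))
      · rw [e]
        exact Spelled.of_square hk h1 (.inr hI')
      · rw [e]
        exact Spelled.of_step hk h1 (.inr hI')

theorem length_relPrefix (n : ℕ) : (relPrefix n).length + 3 ≤ Nat.fib (n + 4) ∧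
    (relPrefix (n + 1)).length + 3 ≤ Nat.fib (n + 5) := by
  induction n with
  | zero => decide
  | succ n ih =>
    refine ⟨ih.2, ?_⟩
    rw [relPrefix, List.length_append, length_fibWord,
      show Nat.fib (n + 1 + 5) = Nat.fib (n + 4) + Nat.fib (n + 5) from Nat.fib_add_two]
    omega

theorem phi_relation_sT (n : ℕ) :
    sgn n * (phi (n + 5) * (phi (n + 4) * phi (n + 4))) =
      eval (relPrefix n) * (phi (n + 5) * phi (n + 4)) := by
  rw [phi_relation, ← mul_assoc]
  congr 1
  rcases Nat.even_or_odd n with h | h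
  · rw [sgn, if_pos h, sT_mul_cancel]
  · rw [sgn, if_neg (Nat.not_even_iff_odd.2 h), one_mul, one_mul]

/-- The words `f_{i+1} f_i f_i` and `s f_{i+1} f_i f_i`, after cancellation, can be shortened. -/
theorem exists_shorter_bad {i : ℕ} (hi : 2 ≤ i) :
    (∃ q, eval q = eval (fibWord (i + 1) ++ fibWord i ++ fibWord i) ∧
      q.length < (fibWord (i + 1) ++ fibWord i ++ fibWord i).length) ∧
    (∃ q, eval q = eval (sCons (fibWord (i + 1) ++ fibWord i ++ fibWord i)) ∧
      q.length < (sCons (fibWord (i + 1) ++ fibWord i ++ fibWord i)).length) := by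
  have hpos : 0 < Nat.fib i := Nat.fib_pos.2 (by omega)
  have hlen : ∀ w, (sCons w).length ≤ w.length + 1 ∧ (Odd (i + 1) → w = (fibWord (i + 1) ++
      fibWord i ++ fibWord i) → w.length = (sCons w).length + 1) ∧
      (Even (i + 1) → w = (fibWord (i + 1) ++ fibWord i ++ fibWord i) →
        (sCons w).length = w.length + 1) := by
    intro w
    refine ⟨?_, ?_, ?_⟩
    · match w with
      | [] => simp [sCons]
      | Letter.s :: w => simp [sCons]; omega
      | Letter.f :: w => simp [sCons]
    · rintro ho rfl
      obtain ⟨w, hw⟩ := fibWord_odd ho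
      simp [hw, sCons]
    · rintro ho rfl
      obtain ⟨w, hw⟩ := fibWord_even ho (by omega)
      simp [hw, sCons]
  rcases Nat.lt_or_ge i 4 with h4 | h4
  · have : i = 2 ∨ i = 3 := by omega
    rcases this with rfl | rfl
    · have e : eval (fibWord 3) = eval (fibWord 3 ++ fibWord 2 ++ fibWord 2) := by
        rw [eval_append, eval_append, mul_assoc]
        exact phi_three_two_two.symm
      refine ⟨⟨fibWord 3, e, by decide⟩, ⟨[Letter.f], ?_, by decide⟩⟩
      rw [eval_sCons, ← e]
      exact (eval_sCons (fibWord 3))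
    · have e : eval (fibWord 4) = eval (fibWord 4 ++ fibWord 3 ++ fibWord 3) := by
        rw [eval_append, eval_append, mul_assoc]
        exact phi_four_three_three.symm
      refine ⟨⟨fibWord 4, e, by decide⟩, ⟨sCons (fibWord 4), ?_, by decide⟩⟩
      rw [eval_sCons, eval_sCons, e]
  · obtain ⟨n, rfl⟩ := Nat.exists_eq_add_of_le' h4
    have hr := (length_relPrefix n).1
    have e : eval (fibWord (n + 4 + 1) ++ fibWord (n + 4) ++ fibWord (n + 4)) =
        phi (n + 5) * (phi (n + 4) * phi (n + 4)) := by
      rw [eval_append, eval_append, mul_assoc]; rfl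
    have hrel := phi_relation_sT n
    rw [← e] at hrel
    set w := fibWord (n + 4 + 1) ++ fibWord (n + 4) ++ fibWord (n + 4) with hw
    set r := relPrefix n ++ (fibWord (n + 5) ++ fibWord (n + 4)) with hr'
    have er : eval r = eval (relPrefix n) * (phi (n + 5) * phi (n + 4)) := by
      rw [hr', eval_append, eval_append]; rfl
    have hl : r.length + 3 ≤ w.length := by
      simp only [hr', hw, List.length_append, length_fibWord, Nat.add_assoc, Nat.reduceAdd]
      omega
    have h1 := hlen w
    have h2 := (hlen r).1
    rw [← er] at hrel
    rcases Nat.even_or_odd n with h | h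
    · rw [sgn, if_pos h] at hrel
      have h1 := h1.2.1 (by grind) rfl
      refine ⟨⟨sCons r, ?_, by omega⟩, ⟨r, ?_, by omega⟩⟩
      · rw [eval_sCons, ← hrel, sT_mul_cancel]
      · rw [eval_sCons, ← hrel]
    · rw [sgn, if_neg (Nat.not_even_iff_odd.2 h), one_mul] at hrel
      have h1 := h1.2.2 (by grind) rfl
      refine ⟨⟨r, hrel.symm, by omega⟩, ⟨sCons r, ?_, by omega⟩⟩
      rw [eval_sCons, ← hrel, eval_sCons]

/-- There is a strictly shorter word that represents the same transformation. -/
def Shortens (w : List Letter) : Prop := ∃ v, eval v = eval w ∧ v.length < w.length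

theorem Shortens.append_left {w : List Letter} (h : Shortens w) (u : List Letter) :
    Shortens (u ++ w) := by
  obtain ⟨v, e, hl⟩ := h
  exact ⟨u ++ v, by rw [eval_append, eval_append, e], by simpa using hl⟩

theorem shortens_append_ss (u v : List Letter) : Shortens (u ++ Letter.s :: Letter.s :: v) :=
  Shortens.append_left ⟨v, by rw [eval_cons_s, eval_cons_s, sT_mul_cancel], by simp⟩ u

theorem EndsBad.shortens {w : List Letter} (h : EndsBad w) : Shortens w ∧ Shortens (sCons w) := by
  obtain ⟨P, i, hi, rfl⟩ := h
  have hb : Shortens (fibWord (i + 1) ++ fibWord i ++ fibWord i) ∧ Shortens (sCons _) :=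
    exists_shorter_bad hi
  refine ⟨hb.1.append_left P, ?_⟩
  rcases eq_or_ne P [] with rfl | hP
  · exact hb.2
  · rw [sCons_append hP]
    exact hb.1.append_left _

/-- The index sequences of normal forms. -/
def Adm (I : List ℕ) : Prop := I = [] ∨ Uni 1 3 I

/-- The word `s^ε f_{i_1} ⋯ f_{i_n}` after cancellation of an initial `s^2`. -/
def redWord (ε : Fin 2) (I : List ℕ) : List Letter :=
  if ε = 0 then fibWords I else sCons (fibWords I)

theorem redWord_zero (I : List ℕ) : redWord 0 I = fibWords I := rfl
theorem redWord_one (I : List ℕ) : redWord 1 I = sCons (fibWords I) := rfl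

theorem eval_redWord (ε : Fin 2) (I : List ℕ) : eval (redWord ε I) = eval (nfWord ε I) := by
  rcases Fin.exists_fin_two.1 ⟨ε, rfl⟩ with rfl | rfl
  · rfl
  · rw [redWord_one, eval_sCons, nfWord, eval_append]
    congr 1

theorem Dec.append_s {m : ℕ} {J : List ℕ} (hm : 2 ≤ m) (h : Dec 1 m J) :
    (∃ w, fibWords J = w ++ [Letter.s]) ∨ Dec 1 m (J ++ [1]) := by
  induction J generalizing m with
  | nil => exact .inr ⟨le_rfl, by omega, trivial⟩
  | cons i J ih =>
    obtain ⟨h1, h2, h3⟩ := h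
    rcases Nat.eq_or_lt_of_le h1 with rfl | hi
    · match J, h3 with
      | [], _ => exact .inl ⟨[], rfl⟩
      | j :: J, ⟨h4, h5, _⟩ => omega
    · rcases ih hi h3 with ⟨w, hw⟩ | h'
      · exact .inl ⟨fibWord i ++ w, by rw [fibWords_cons, hw, List.append_assoc]⟩
      · exact .inr ⟨h1, h2, h'⟩

theorem Uni.append_s {k : ℕ} {I : List ℕ} (hk : 2 ≤ k) (h : Uni 1 k I) :
    (∃ w, fibWords I = w ++ [Letter.s] ∧ w ≠ []) ∨ Uni 1 k (I ++ [1]) := by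
  induction I generalizing k with
  | nil => exact h.elim
  | cons i J ih =>
    obtain ⟨h1, h2⟩ := h
    have hi : fibWord i ≠ [] := fibWord_ne_nil (by omega)
    have : (∃ w, fibWords J = w ++ [Letter.s]) ∨ Uni 1 k (i :: J ++ [1]) := by
      rcases h2 with h2 | h2
      · exact (h2.append_s (hk.trans h1)).imp_right fun h => ⟨h1, .inl h⟩
      · rcases ih (by omega) h2 with ⟨w, hw, _⟩ | h
        · exact .inl ⟨w, hw⟩
        · exact .inr ⟨h1, .inr h⟩
    refine this.imp_left ?_
    rintro ⟨w, hw⟩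
    exact ⟨fibWord i ++ w, by rw [fibWords_cons, hw, List.append_assoc], by simp [hi]⟩

/-- The word is the cancelled spelling of a normal form, or it can be shortened. -/
def Good (w : List Letter) : Prop := (∃ ε I, Adm I ∧ w = redWord ε I) ∨ Shortens w

theorem good_s_cons {I : List ℕ} (h : Adm I) : Good (Letter.s :: fibWords I) := by
  cases hw : fibWords I with
  | nil => exact .inl ⟨1, I, h, by rw [redWord_one, hw]; rfl⟩
  | cons a w =>
    cases a with
    | s => exact .inr (shortens_append_ss [] w)
    | f => exact .inl ⟨1, I, h, by rw [redWord_one, hw]; rfl⟩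

theorem Spelled.good {w : List Letter} (h : Spelled 3 w) : Good w ∧ Good (sCons w) := by
  rcases h with ⟨I, hI, rfl⟩ | hb | ⟨I, hI, rfl⟩ | ⟨I, hI, rfl⟩
  · exact ⟨.inl ⟨0, I, .inr hI, rfl⟩, .inl ⟨1, I, .inr hI, rfl⟩⟩
  · exact ⟨.inr hb.shortens.1, .inr hb.shortens.2⟩
  · have hA : Adm I := .inr (hI.mono (by omega))
    exact ⟨good_s_cons hA, .inl ⟨0, I, hA, rfl⟩⟩
  · have hA : Adm (3 :: I) := .inr ⟨le_rfl, .inr hI⟩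
    exact ⟨.inl ⟨1, _, hA, rfl⟩, .inl ⟨0, _, hA, rfl⟩⟩

theorem good_redWord_append {I : List ℕ} (h : Adm I) (ε : Fin 2) (a : Letter) :
    Good (redWord ε I ++ [a]) := by
  rcases h with rfl | h
  · rcases Fin.exists_fin_two.1 ⟨ε, rfl⟩ with rfl | rfl <;> cases a
    · exact .inl ⟨1, [], .inl rfl, rfl⟩
    · exact .inl ⟨1, [3], .inr ⟨le_rfl, .inl trivial⟩, rfl⟩
    · exact .inr (shortens_append_ss [] [])
    · exact .inl ⟨0, [3], .inr ⟨le_rfl, .inl trivial⟩, rfl⟩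
  · have hne := h.fibWords_ne_nil (by omega)
    cases a with
    | f =>
      have hs := (h.append_f le_rfl).good
      rcases Fin.exists_fin_two.1 ⟨ε, rfl⟩ with rfl | rfl
      · exact hs.1
      · rw [redWord_one, ← sCons_append hne]
        exact hs.2
    | s =>
      rcases h.append_s (by omega) with ⟨w, hw, hw0⟩ | h'
      · right
        rcases Fin.exists_fin_two.1 ⟨ε, rfl⟩ with rfl | rfl
        · rw [redWord_zero, hw, List.append_assoc]
          exact shortens_append_ss w []
        · rw [redWord_one, hw, sCons_append hw0, List.append_assoc]
          exact shortens_append_ss _ []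
      · refine .inl ⟨ε, I ++ [1], .inr h', ?_⟩
        have e : fibWords (I ++ [1]) = fibWords I ++ [Letter.s] := by
          rw [fibWords, List.flatMap_append]; rfl
        rcases Fin.exists_fin_two.1 ⟨ε, rfl⟩ with rfl | rfl
        · rw [redWord_zero, redWord_zero, e]
        · rw [redWord_one, redWord_one, e, sCons_append hne]

/-- Every word is the cancelled spelling of a normal form, or it can be shortened. -/
theorem good_word (w : List Letter) : Good w := by
  induction hn : w.length using Nat.strong_induction_on generalizing w with
  | _ n ih =>
    rcases List.eq_nil_or_concat w with rfl | ⟨u, a, rfl⟩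
    · exact .inl ⟨0, [], .inl rfl, rfl⟩
    · rw [List.concat_eq_append] at *
      rcases ih u.length (by simp at hn; omega) u rfl with ⟨ε, I, hI, rfl⟩ | ⟨v, e, hl⟩
      · exact good_redWord_append hI ε a
      · exact .inr ⟨v ++ [a], by rw [eval_append, eval_append, e], by simpa using hl⟩

/-- The product of the transformations `f_i` for `i` in the index sequence. -/
noncomputable def phiProd (I : List ℕ) : Transf := (I.map phi).prod

theorem phiProd_nil : phiProd [] = 1 := rfl

theorem phiProd_cons (i : ℕ) (I : List ℕ) : phiProd (i :: I) = phi i * phiProd I := by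
  simp [phiProd]

theorem phiProd_append (I J : List ℕ) : phiProd (I ++ J) = phiProd I * phiProd J := by
  simp [phiProd]

theorem phiProd_singleton (i : ℕ) : phiProd [i] = phi i := by simp [phiProd]

theorem eval_fibWords (I : List ℕ) : eval (fibWords I) = phiProd I := by
  induction I with
  | nil => exact eval_nil
  | cons i I ih => rw [fibWords_cons, eval_append, ih, phiProd_cons, phi]

/-- The index sequence shifted down by one. -/
abbrev pr (I : List ℕ) : List ℕ := I.map Nat.pred

theorem pr_cons (i : ℕ) (I : List ℕ) : pr (i :: I) = i.pred :: pr I := rfl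

/-- The admissible continuations of an index sequence after the entry `k`. -/
def Tail (lo k : ℕ) (L : List ℕ) : Prop := Dec lo k L ∨ Uni lo (k + 2) L

theorem Dec.pr {lo m : ℕ} {I : List ℕ} (h : Dec (lo + 1) m I) : Dec lo (m - 1) (pr I) := by
  induction I generalizing m with
  | nil => trivial
  | cons i I ih =>
    obtain ⟨h1, h2, h3⟩ := h
    exact ⟨by simp only [Nat.pred_eq_sub_one]; omega, by simp only [Nat.pred_eq_sub_one]; omega,
      ih h3⟩

theorem Uni.pr {lo k : ℕ} {I : List ℕ} (hk : 1 ≤ k) (h : Uni (lo + 1) k I) :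
    Uni lo (k - 1) (pr I) := by
  induction I generalizing k with
  | nil => exact h.elim
  | cons i I ih =>
    obtain ⟨h1, h2⟩ := h
    refine ⟨by simp only [Nat.pred_eq_sub_one]; omega, h2.imp (fun h => h.pr) fun h => ?_⟩
    have := ih (by omega) h
    rwa [show i + 2 - 1 = i.pred + 2 by simp only [Nat.pred_eq_sub_one]; omega] at this

theorem Dec.le {lo m : ℕ} {I : List ℕ} (h : Dec lo m I) : ∀ i ∈ I, lo ≤ i := by
  induction I generalizing m with
  | nil => simp
  | cons i I ih =>
    obtain ⟨h1, h2, h3⟩ := h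
    exact List.forall_mem_cons.2 ⟨h1, ih h3⟩

theorem Uni.le {lo k : ℕ} {I : List ℕ} (hk : lo ≤ k) (h : Uni lo k I) : ∀ i ∈ I, lo ≤ i := by
  induction I generalizing k with
  | nil => simp
  | cons i I ih =>
    obtain ⟨h1, h2 | h2⟩ := h
    · exact List.forall_mem_cons.2 ⟨by omega, h2.le⟩
    · exact List.forall_mem_cons.2 ⟨by omega, ih (by omega) h2⟩

theorem Tail.le {lo k : ℕ} {I : List ℕ} (hk : lo ≤ k) (h : Tail lo k I) : ∀ i ∈ I, lo ≤ i :=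
  h.elim (fun h => h.le) fun h => h.le (by omega)

/-- A weight for index sequences that is halved by shifting down. -/
def wt (I : List ℕ) : ℕ := (I.map (2 ^ ·)).sum

theorem wt_nil : wt [] = 0 := rfl

theorem wt_cons (i : ℕ) (I : List ℕ) : wt (i :: I) = 2 ^ i + wt I := by simp [wt]

theorem wt_append (I J : List ℕ) : wt (I ++ J) = wt I + wt J := by simp [wt]

theorem wt_pr {I : List ℕ} (h : ∀ i ∈ I, 1 ≤ i) : 2 * wt (pr I) = wt I := by
  induction I with
  | nil => rfl
  | cons i I ih =>
    obtain ⟨h1, h2⟩ := List.forall_mem_cons.1 h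
    obtain ⟨n, rfl⟩ := Nat.exists_eq_add_of_le' h1
    rw [pr_cons, wt_cons, wt_cons, mul_add, ih h2, Nat.pred_succ, pow_succ, mul_comm]

theorem pr_inj {I J : List ℕ} (hI : ∀ i ∈ I, 1 ≤ i) (hJ : ∀ i ∈ J, 1 ≤ i) (h : pr I = pr J) :
    I = J := by
  have key : ∀ {K : List ℕ}, (∀ i ∈ K, 1 ≤ i) → (pr K).map Nat.succ = K := by
    intro K hK
    rw [List.map_map]
    conv_rhs => rw [← List.map_id K]
    exact List.map_congr_left fun i hi => Nat.succ_pred_eq_of_pos (hK i hi)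
  rw [← key hI, h, key hJ]

theorem Sec.mul_phiProd {g a b : Transf} {I : List ℕ} (hg : Sec g a b) (hI : ∀ i ∈ I, 2 ≤ i) :
    Sec (g * phiProd I) (a * phiProd (pr I)) (b * phiProd (pr I)) := by
  induction I generalizing g a b with
  | nil => simpa [phiProd_nil] using hg
  | cons i I ih =>
    obtain ⟨h1, h2⟩ := List.forall_mem_cons.1 hI
    obtain ⟨n, rfl⟩ := Nat.exists_eq_add_of_le' h1
    have := ih (hg.mul (sec_phi n).1) h2
    rw [pr_cons, phiProd_cons, phiProd_cons, ← mul_assoc, ← mul_assoc, ← mul_assoc]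
    exact this

theorem sec_phiProd {i : ℕ} {L : List ℕ} (hi : 2 ≤ i) (hL : ∀ j ∈ L, 2 ≤ j) :
    Sec (phiProd (i :: L)) (alpha i * phiProd (pr L)) (phi (i - 1) * phiProd (pr L)) := by
  obtain ⟨n, rfl⟩ := Nat.exists_eq_add_of_le' hi
  rw [phiProd_cons]
  exact (sec_phi n).1.mul_phiProd hL

theorem phi_mul_succ {k : ℕ} (hk : 1 ≤ k) : phi k * phi (k + 1) = phi (k + 2) := by
  obtain ⟨n, rfl⟩ := Nat.exists_eq_add_of_le' hk
  exact (phi_add_three n).symm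

/-- The normal form of `k` followed by the shifted sequence `L`. -/
def mrg : ℕ → List ℕ → List ℕ
  | k, [] => [k]
  | k, j :: L => if j = k + 2 then mrg (k + 2) L else k :: pr (j :: L)

theorem mrg_cons_self (k : ℕ) (L : List ℕ) : mrg k ((k + 2) :: L) = mrg (k + 2) L := by
  rw [mrg, if_pos rfl]

theorem mrg_cons_of_ne {k j : ℕ} (h : j ≠ k + 2) (L : List ℕ) :
    mrg k (j :: L) = k :: pr (j :: L) := by
  rw [mrg, if_neg h]

theorem phiProd_mrg {k : ℕ} (hk : 1 ≤ k) (L : List ℕ) :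
    phiProd (mrg k L) = phi k * phiProd (pr L) := by
  induction L generalizing k with
  | nil => rw [mrg, phiProd_singleton]; exact (mul_one _).symm
  | cons j L ih =>
    rcases eq_or_ne j (k + 2) with rfl | h
    · rw [mrg_cons_self, ih (by omega), ← phi_mul_succ hk, pr_cons, phiProd_cons, mul_assoc]
      rfl
    · rw [mrg_cons_of_ne h, phiProd_cons]

theorem Tail.uni_mrg {k : ℕ} {L : List ℕ} (h : Tail 2 k L) : Uni 1 k (mrg k L) := by
  induction L generalizing k with
  | nil => exact ⟨le_rfl, .inl trivial⟩
  | cons j L ih =>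
    rcases eq_or_ne j (k + 2) with rfl | hj
    · rw [mrg_cons_self]
      rcases h with ⟨_, h2, _⟩ | ⟨_, h2⟩
      · omega
      · exact (ih h2).mono (by omega)
    · rw [mrg_cons_of_ne hj]
      refine ⟨le_rfl, ?_⟩
      rcases h with h | ⟨h1, h2⟩
      · exact .inl (h.pr.mono (by omega))
      · have h3 : Uni 2 (k + 3) (j :: L) := ⟨by omega, h2⟩
        exact .inr (h3.pr (by omega))

theorem mrg_eq_cons {k i : ℕ} {L K : List ℕ} (h : mrg k L = i :: K) :
    i = k ∨ k + 2 ≤ i ∧ ∃ M, L = (k + 2) :: M := by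
  induction L generalizing k with
  | nil => exact .inl (List.cons.inj h).1.symm
  | cons j L ih =>
    rcases eq_or_ne j (k + 2) with rfl | hj
    · rw [mrg_cons_self] at h
      refine .inr ⟨?_, L, rfl⟩
      rcases ih h with h | h <;> omega
    · rw [mrg_cons_of_ne hj] at h
      exact .inl (List.cons.inj h).1.symm

theorem mrg_ne_nil (k : ℕ) (L : List ℕ) : mrg k L ≠ [] := by
  induction L generalizing k with
  | nil => simp [mrg]
  | cons j L ih =>
    rcases eq_or_ne j (k + 2) with rfl | hj
    · rw [mrg_cons_self]; exact ih _
    · rw [mrg_cons_of_ne hj]; simp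

theorem mrg_inj {k : ℕ} {L L' : List ℕ} (hL : ∀ i ∈ L, 1 ≤ i) (hL' : ∀ i ∈ L', 1 ≤ i)
    (h : mrg k L = mrg k L') : L = L' := by
  have key : ∀ (k : ℕ) (L : List ℕ), mrg k L = k :: pr L ∨ ∃ M, L = (k + 2) :: M := by
    intro k L
    match L with
    | [] => exact .inl rfl
    | j :: L =>
      rcases eq_or_ne j (k + 2) with rfl | hj
      · exact .inr ⟨L, rfl⟩
      · exact .inl (mrg_cons_of_ne hj L)
  have large : ∀ (k : ℕ) (M K : List ℕ), mrg k ((k + 2) :: M) ≠ k :: K := by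
    intro k M K h
    rw [mrg_cons_self] at h
    rcases mrg_eq_cons h with h | h <;> omega
  induction L generalizing k L' with
  | nil =>
    rcases key k L' with h' | ⟨M, rfl⟩
    · rw [h'] at h
      exact pr_inj hL hL' (List.cons.inj h).2
    · exact (large k M _ h.symm).elim
  | cons j L ih =>
    rcases key k (j :: L) with h1 | ⟨M, hM⟩ <;> rcases key k L' with h2 | ⟨M', rfl⟩
    · rw [h1, h2] at h
      exact pr_inj hL hL' (List.cons.inj h).2
    · exact (large k M' _ (h.symm.trans h1)).elim
    · rw [hM] at h
      exact (large k M _ (h.trans h2)).elim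
    · obtain ⟨rfl, rfl⟩ := List.cons.inj hM
      rw [mrg_cons_self, mrg_cons_self] at h
      rw [ih (fun i hi => hL i (List.mem_cons_of_mem _ hi))
        (fun i hi => hL' i (List.mem_cons_of_mem _ hi)) h]

theorem wt_mrg_le {k : ℕ} {L : List ℕ} (hL : ∀ i ∈ L, 1 ≤ i) :
    wt (mrg k L) ≤ 2 ^ k + wt L ∧ (L ≠ [] → wt (mrg k L) < 2 ^ k + wt L) := by
  induction L generalizing k with
  | nil => exact ⟨by simp [mrg, wt], fun h => (h rfl).elim⟩
  | cons j L ih =>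
    suffices wt (mrg k (j :: L)) < 2 ^ k + wt (j :: L) from ⟨this.le, fun _ => this⟩
    rcases eq_or_ne j (k + 2) with rfl | hj
    · rw [mrg_cons_self, wt_cons]
      have := (ih (k := k + 2) fun i hi => hL i (List.mem_cons_of_mem _ hi)).1
      have : 0 < 2 ^ k := by positivity
      omega
    · rw [mrg_cons_of_ne hj, wt_cons]
      have h1 := wt_pr hL
      have h2 : 0 < wt (j :: L) := by rw [wt_cons]; positivity
      omega

/-- The sequence `a, a + 2, a + 4, …` of length `n`. -/
def stair (a : ℕ) : ℕ → List ℕ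
  | 0 => []
  | n + 1 => a :: stair (a + 2) n

theorem stair_succ (a n : ℕ) : stair a (n + 1) = stair a n ++ [a + 2 * n] := by
  induction n generalizing a with
  | zero => rfl
  | succ n ih =>
    rw [stair, ih (a + 2)]
    rw [show a + 2 + 2 * n = a + 2 * (n + 1) by ring]
    rfl

theorem Tail.uni_stair {lo a n : ℕ} {K : List ℕ} (h : Tail lo (a + 2 * n) K) :
    Uni lo a (stair a (n + 1) ++ K) := by
  induction n generalizing a with
  | zero => exact ⟨le_rfl, h⟩
  | succ n ih =>
    refine ⟨le_rfl, .inr (ih ?_)⟩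
    rwa [show a + 2 + 2 * n = a + 2 * (n + 1) by ring]

theorem phiProd_stair_mul (a n : ℕ) :
    phiProd (stair (a + 3) (n + 1)) * phi (a + 3 + 2 * n) =
      phi (a + 1) * phiProd (stair (a + 4) (n + 1)) := by
  induction n generalizing a with
  | zero =>
    simp only [stair, phiProd_singleton]
    exact phi_mul_self a
  | succ n ih =>
    rw [stair, phiProd_cons, mul_assoc, show a + 3 + 2 * (n + 1) = a + 2 + 3 + 2 * n by ring,
      ih (a + 2), ← mul_assoc, phi_mul_self, mul_assoc, ← phiProd_cons]
    rfl

theorem wt_stair (a n : ℕ) : 3 * wt (stair a n) + 2 ^ a = 2 ^ (a + 2 * n) := by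
  induction n generalizing a with
  | zero => simp [stair, wt]
  | succ n ih =>
    rw [stair, wt_cons, show a + 2 * (n + 1) = a + 2 + 2 * n by ring, ← ih (a + 2)]
    ring

theorem alpha_odd (n : ℕ) : alpha (2 * n + 5) = sT * phiProd (stair 3 (n + 1)) := by
  induction n with
  | zero => rw [alpha_five, stair, stair, phiProd_singleton, phi_three, sT_mul_cancel]
  | succ n ih =>
    rw [stair_succ, phiProd_append, ← mul_assoc, ← ih, phiProd_singleton,
      show 3 + 2 * (n + 1) = 2 * n + 5 by ring]
    rfl

theorem alpha_even (n : ℕ) : alpha (2 * n + 6) = phiProd (stair 4 (n + 1)) := by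
  induction n with
  | zero => rw [alpha_six, stair, stair, phiProd_singleton]
  | succ n ih =>
    rw [stair_succ, phiProd_append, ← ih, phiProd_singleton,
      show 4 + 2 * (n + 1) = 2 * n + 6 by ring]
    rfl

theorem Tail.pr_or {j : ℕ} {M : List ℕ} (hj : 3 ≤ j) (h : Tail 2 j M) :
    (∃ M', M = (j - 1) :: M' ∧ Dec 2 (j - 1) M') ∨ Tail 1 (j - 2) (pr M) := by
  rcases h with h | h
  · match M, h with
    | [], _ => exact .inr (.inl trivial)
    | i :: M, ⟨h1, h2, h3⟩ =>
      rcases Nat.lt_or_ge i (j - 1) with hi | hi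
      · have : Dec 2 (j - 1) (i :: M) := ⟨h1, hi, h3⟩
        exact .inr (.inl this.pr)
      · obtain rfl : i = j - 1 := by omega
        exact .inl ⟨M, rfl, h3⟩
  · exact .inr (.inr ((h.pr (by omega)).mono (by omega)))

/-- Normal forms for the even section of a product whose first index is at least five. -/
theorem even_section {j : ℕ} {M : List ℕ} (hj : 5 ≤ j) (h : Tail 2 j M) :
    (∃ K, Uni 1 3 K ∧ alpha j * phiProd (pr M) = sT * phiProd K ∧ wt K < wt (j :: M)) ∨
    (∃ K, Uni 1 3 (4 :: K) ∧ alpha j * phiProd (pr M) = phiProd (4 :: K) ∧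
      wt (4 :: K) < wt (j :: M) ∧ (j = 5 → ∃ M', M = 4 :: M' ∧ K = pr M')) := by
  have hw := wt_pr fun i hi => (h.le (by omega) i hi).trans' one_le_two
  rcases Nat.even_or_odd' (j - 5) with ⟨n, hn | hn⟩
  · obtain rfl : j = 2 * n + 5 := by omega
    have hs := wt_stair 3 (n + 1)
    have hs4 := wt_stair 4 (n + 1)
    rw [show 3 + 2 * (n + 1) = 2 * n + 5 by ring] at hs
    rw [show 4 + 2 * (n + 1) = 2 * n + 5 + 1 by ring, pow_succ] at hs4
    rcases h.pr_or (by omega) with ⟨M', rfl, hM'⟩ | h'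
    · right
      have hw' := wt_pr fun i hi => (hM'.le i hi).trans' one_le_two
      refine ⟨stair 6 n ++ pr M', ?_, ?_, ?_, ?_⟩
      · refine Uni.mono (k := 4) (Tail.uni_stair (n := n) (.inl ?_)) (by omega)
        exact hM'.pr.mono (by omega)
      · rw [pr_cons, phiProd_cons, alpha_odd,
          show Nat.pred (2 * n + 5 - 1) = 0 + 3 + 2 * n by rw [Nat.pred_eq_sub_one]; omega,
          ← mul_assoc, mul_assoc sT, phiProd_stair_mul 0 n, phi_one, sT_mul_cancel,
          ← phiProd_append]
        rfl
      · rw [← List.cons_append, wt_append, wt_cons (2 * n + 5), wt_cons (2 * n + 5 - 1)]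
        change wt (stair 4 (n + 1)) + _ < _
        have : 2 ^ (2 * n + 5) = 2 * 2 ^ (2 * n + 5 - 1) := by
          rw [← pow_succ']; congr 1
        omega
      · intro h5
        obtain rfl : n = 0 := by omega
        exact ⟨M', rfl, rfl⟩
    · left
      refine ⟨stair 3 (n + 1) ++ pr M, ?_, ?_, ?_⟩
      · apply Tail.uni_stair
        rwa [show 3 + 2 * n = 2 * n + 5 - 2 by omega]
      · rw [alpha_odd, phiProd_append, mul_assoc]
      · rw [wt_append, wt_cons]
        omega
  · obtain rfl : j = 2 * n + 6 := by omega
    have hs := wt_stair 3 (n + 2)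
    have hs4 := wt_stair 4 (n + 1)
    rw [show 3 + 2 * (n + 2) = 2 * n + 6 + 1 by ring, pow_succ] at hs
    rw [show 4 + 2 * (n + 1) = 2 * n + 6 by ring] at hs4
    rcases h.pr_or (by omega) with ⟨M', rfl, hM'⟩ | h'
    · left
      have hw' := wt_pr fun i hi => (hM'.le i hi).trans' one_le_two
      refine ⟨stair 3 (n + 2) ++ pr M', ?_, ?_, ?_⟩
      · refine Tail.uni_stair (.inl (hM'.pr.mono (by omega)))
      · rw [pr_cons, phiProd_cons, alpha_even,
          show Nat.pred (2 * n + 6 - 1) = 1 + 3 + 2 * n by rw [Nat.pred_eq_sub_one]; omega,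
          ← mul_assoc, phiProd_stair_mul 1 n, show stair 3 (n + 2) = 3 :: stair 5 (n + 1) from rfl,
          List.cons_append, phiProd_cons 3, phiProd_append, phi_three, mul_assoc sT, sT_mul_cancel]
        change phi 2 * _ * _ = _
        rw [phi_two, mul_assoc]
      · rw [wt_append, wt_cons, wt_cons]
        have : 2 ^ (2 * n + 6) = 2 * 2 ^ (2 * n + 6 - 1) := by
          rw [← pow_succ']; congr 1
        omega
    · right
      refine ⟨stair 6 n ++ pr M, ?_, ?_, ?_, fun h5 => by omega⟩
      · refine Uni.mono (k := 4) (Tail.uni_stair (n := n) ?_) (by omega)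
        rwa [show 4 + 2 * n = 2 * n + 6 - 2 by omega]
      · rw [alpha_even, ← phiProd_append]
        rfl
      · rw [← List.cons_append, wt_append, wt_cons (2 * n + 6)]
        change wt (stair 4 (n + 1)) + _ < _
        omega

/-- Admissible sequences of total weight below `n` represent distinct transformations, even up to
multiplication by `s`. -/
def Distinct (n : ℕ) : Prop :=
  ∀ I J, Adm I → Adm J → wt I + wt J < n →
    (phiProd I = phiProd J → I = J) ∧ phiProd I ≠ sT * phiProd J

theorem tail_three {L : List ℕ} (h : Tail 2 3 L) : Adm (pr L) ∨ L = [2] := by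
  rcases h with h | h
  · match L, h with
    | [], _ => exact .inl (.inl rfl)
    | i :: L, ⟨h1, h2, h3⟩ =>
      obtain rfl : i = 2 := by omega
      match L, h3 with
      | [], _ => exact .inr rfl
      | j :: L, ⟨h4, h5, _⟩ => omega
  · exact .inl (.inr ((h.pr (by omega)).mono (by omega)))

theorem Uni.adm_pr {k : ℕ} {I : List ℕ} (hk : 4 ≤ k) (h : Uni 2 k I) :
    Adm (FibSemigroup.pr I) :=
  .inr ((h.pr (by omega)).mono (by omega))

theorem Tail.wt_pr {k : ℕ} {L : List ℕ} (hk : 2 ≤ k) (h : Tail 2 k L) : 2 * wt (pr L) = wt L :=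
  FibSemigroup.wt_pr fun i hi => (h.le hk i hi).trans' one_le_two

theorem Tail.one_le {k : ℕ} {L : List ℕ} (hk : 2 ≤ k) (h : Tail 2 k L) : ∀ i ∈ L, 1 ≤ i :=
  fun i hi => (h.le hk i hi).trans' one_le_two

theorem phiProd_pr_cons (i : ℕ) (L : List ℕ) :
    phiProd (pr (i :: L)) = phi (i - 1) * phiProd (pr L) := phiProd_cons _ _

theorem wt_pr_cons {i : ℕ} {L : List ℕ} (hi : 2 ≤ i) (h : Tail 2 i L) :
    2 * wt (pr (i :: L)) = wt (i :: L) :=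
  wt_pr (List.forall_mem_cons.2 ⟨by omega, h.one_le hi⟩)

theorem odd_section_three (L : List ℕ) :
    phi (3 - 1) * phiProd (pr L) = sT * phiProd (mrg 3 L) := by
  rw [phiProd_mrg (by omega), ← mul_assoc, phi_three, sT_mul_cancel]
  exact congrArg (· * _) phi_two

theorem Distinct.same {n i j : ℕ} {L M : List ℕ} (ih : Distinct n) (hi : 3 ≤ i) (hj : 3 ≤ j)
    (hL : Tail 2 i L) (hM : Tail 2 j M) (hw : wt (i :: L) + wt (j :: M) ≤ n)
    (h : phi (i - 1) * phiProd (pr L) = phi (j - 1) * phiProd (pr M)) : i :: L = j :: M := by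
  have hwL := wt_pr_cons (by omega) hL
  have hwM := wt_pr_cons (by omega) hM
  have hL1 := hL.one_le (by omega)
  have hM1 := hM.one_le (by omega)
  have mix : ∀ {j : ℕ} {L M : List ℕ}, 4 ≤ j → Tail 2 3 L → Tail 2 j M →
      wt (3 :: L) + wt (j :: M) ≤ n →
      phi (3 - 1) * phiProd (pr L) ≠ phi (j - 1) * phiProd (pr M) := by
    intro j L M hj hL hM hw h
    rw [odd_section_three, ← phiProd_pr_cons] at h
    refine (ih (pr (j :: M)) (mrg 3 L) ?_ (.inr hL.uni_mrg) ?_).2 h.symm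
    · exact Uni.adm_pr hj ⟨le_rfl, hM⟩
    · have h1 := wt_pr_cons (by omega) hM
      have h2 := (wt_mrg_le (k := 3) (hL.one_le (by omega))).1
      rw [wt_cons 3] at hw
      have : 0 < wt (j :: M) := by rw [wt_cons]; positivity
      omega
  rcases Nat.eq_or_lt_of_le hi with rfl | hi4 <;> rcases Nat.eq_or_lt_of_le hj with rfl | hj4
  · rcases eq_or_ne L M with rfl | hne
    · rfl
    rw [odd_section_three, odd_section_three] at h
    have h := (ih _ _ (.inr hL.uni_mrg) (.inr hM.uni_mrg) ?_).1 (sT_mul_left_inj h)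
    · rw [mrg_inj hL1 hM1 h]
    · have h1 := wt_mrg_le (k := 3) hL1
      have h2 := wt_mrg_le (k := 3) hM1
      rw [wt_cons, wt_cons] at hw
      rcases eq_or_ne L [] with rfl | hL0
      · have := h2.2 hne.symm
        omega
      · have := h1.2 hL0
        omega
  · exact (mix hj4 hL hM hw h).elim
  · exact (mix hi4 hM hL (by omega) h.symm).elim
  · rw [← phiProd_pr_cons, ← phiProd_pr_cons] at h
    have h := (ih _ _ (Uni.adm_pr (I := i :: L) hi4 ⟨le_rfl, hL⟩)
      (Uni.adm_pr (I := j :: M) hj4 ⟨le_rfl, hM⟩) ?_).1 h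
    · exact pr_inj (List.forall_mem_cons.2 ⟨by omega, hL1⟩)
        (List.forall_mem_cons.2 ⟨by omega, hM1⟩) h
    · have : 0 < wt (i :: L) := by rw [wt_cons]; positivity
      omega

/-- If the odd section starting with `i ≥ 4` equals the even section starting with `j ≥ 5`, both
indices are five. -/
theorem Distinct.eq_five {n i j : ℕ} {L M : List ℕ} (ih : Distinct n) (hi : 4 ≤ i) (hj : 5 ≤ j)
    (hL : Tail 2 i L) (hM : Tail 2 j M) (hw : wt (i :: L) + wt (j :: M) ≤ n)
    (h : phi (i - 1) * phiProd (pr L) = alpha j * phiProd (pr M)) :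
    i = 5 ∧ (j = 5 → ∃ M', M = 4 :: M' ∧ pr L = pr M') := by
  have hA : Adm (pr (i :: L)) := Uni.adm_pr hi ⟨le_rfl, hL⟩
  have hwL := wt_pr_cons (by omega) hL
  rw [← phiProd_pr_cons] at h
  rcases even_section hj hM with ⟨K, hK, e, hwK⟩ | ⟨K, hK, e, hwK, h5⟩
  · exact ((ih _ _ hA (.inr hK) (by omega)).2 (h.trans e)).elim
  · have := (ih _ _ hA (.inr hK) (by omega)).1 (h.trans e)
    obtain ⟨h1, h2⟩ := List.cons.inj this
    rw [Nat.pred_eq_sub_one] at h1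
    refine ⟨by omega, fun hj5 => ?_⟩
    obtain ⟨M', h3, h4⟩ := h5 hj5
    exact ⟨M', h3, h2.trans h4⟩

theorem Distinct.three_left {n j : ℕ} {L M : List ℕ} (ih : Distinct n) (hj : 4 ≤ j)
    (hL : Tail 2 3 L) (hM : Tail 2 j M) (hw : wt (3 :: L) + wt (j :: M) ≤ n) :
    alpha 3 * phiProd (pr L) ≠ phi (j - 1) * phiProd (pr M) := by
  intro h
  have hA : Adm (pr (j :: M)) := Uni.adm_pr hj ⟨le_rfl, hM⟩
  have hwM := wt_pr_cons (by omega) hM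
  have hwL := hL.wt_pr (by omega)
  rw [wt_cons 3] at hw
  rw [← phiProd_pr_cons] at h
  rcases tail_three hL with hL' | rfl
  · exact (ih _ _ hA hL' (by omega)).2 h.symm
  · have : alpha 3 * phiProd (pr [2]) = phiProd [] := by
      change sT * phiProd [1] = 1
      rw [phiProd_singleton, phi_one, sT_mul_self]
    rw [this] at h
    have h := (ih _ _ (.inl rfl) hA (by rw [wt_nil]; omega)).1 h
    simp at h

theorem Distinct.three_three {n : ℕ} {L M : List ℕ} (ih : Distinct n)
    (hL : Tail 2 3 L) (hM : Tail 2 3 M) (hw : wt (3 :: L) + wt (3 :: M) ≤ n)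
    (h0 : alpha 3 * phiProd (pr L) = phi (3 - 1) * phiProd (pr M))
    (h1 : phi (3 - 1) * phiProd (pr L) = alpha 3 * phiProd (pr M)) : False := by
  have key : ∀ {L M : List ℕ}, Tail 2 3 L → Tail 2 3 M → wt (3 :: L) + wt (3 :: M) ≤ n →
      phi (3 - 1) * phiProd (pr L) = alpha 3 * phiProd (pr M) →
      Adm (pr M) ∧ mrg 3 L = pr M := by
    intro L M hL hM hw h
    rw [odd_section_three] at h
    have h := sT_mul_left_inj h
    have h1 := (wt_mrg_le (k := 3) (hL.one_le (by omega))).1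
    have h2 := hM.wt_pr (by omega)
    rw [wt_cons, wt_cons] at hw
    rcases tail_three hM with hM' | rfl
    · exact ⟨hM', (ih _ _ (.inr hL.uni_mrg) hM' (by omega)).1 h⟩
    · refine ((ih _ _ (.inl rfl) (.inr hL.uni_mrg) (by rw [wt_nil]; omega)).2 ?_).elim
      rw [h]
      change 1 = sT * phiProd [1]
      rw [phiProd_singleton, phi_one, sT_mul_self]
  have five : ∀ {L M : List ℕ}, Adm (pr M) → Tail 2 3 M → mrg 3 L = pr M →
      ∃ M' m, M = m :: M' ∧ 5 ≤ m ∧ (∃ L', L = 5 :: L') ∧ (m = 5 → False) := by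
    intro L M hA hM h
    match M, hA, hM, h with
    | [], _, _, h => exact (mrg_ne_nil _ _ h).elim
    | m :: M, hA, hM, h =>
      have hm : 4 ≤ m := by
        rcases hA with h | h
        · simp at h
        · have := h.1
          rw [Nat.pred_eq_sub_one] at this
          omega
      have hm5 : 5 ≤ m := by
        rcases hM with h | h
        · have := h.2.1
          omega
        · exact h.1
      refine ⟨M, m, rfl, hm5, ?_⟩
      rcases mrg_eq_cons h with h | ⟨h, L', h'⟩
      · rw [Nat.pred_eq_sub_one] at h
        omega
      · rw [Nat.pred_eq_sub_one] at h
        exact ⟨⟨L', h'⟩, by omega⟩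
  obtain ⟨a1, e1⟩ := key hL hM hw h1
  obtain ⟨a2, e2⟩ := key hM hL (by omega) h0.symm
  obtain ⟨M', m, rfl, hm, ⟨L', rfl⟩, hm5⟩ := five a1 hM e1
  obtain ⟨_, _, _, _, ⟨M'', h⟩, _⟩ := five a2 hL e2
  exact hm5 (List.cons.inj h).1

theorem ff_small {M : List ℕ} (h : Dec 2 4 M) :
    ∃ K, Uni 1 3 K ∧ alpha 4 * phiProd (pr M) = sT * phiProd K ∧ wt K ≤ 14 := by
  have e : ∀ K, alpha 4 * phiProd K = sT * phiProd (3 :: 2 :: K) := by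
    intro K
    rw [phiProd_cons, phiProd_cons, phi_three, phi_two, alpha_four, mul_assoc, mul_assoc,
      sT_mul_cancel]
  have e2 : ∀ K, phiProd (3 :: 2 :: 2 :: K) = phiProd (3 :: K) := by
    intro K
    simp only [phiProd_cons]
    rw [← mul_assoc (phi 2), ← mul_assoc (phi 3), phi_three_two_two]
  match M, h with
  | [], _ =>
    exact ⟨[3, 2], ⟨le_rfl, .inl ⟨by omega, by omega, trivial⟩⟩, e [], by decide⟩
  | [i], ⟨h1, h2, _⟩ =>
    obtain rfl | rfl : i = 2 ∨ i = 3 := by omega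
    · exact ⟨[3, 2, 1], ⟨le_rfl, .inl ⟨by omega, by omega, by omega, by omega, trivial⟩⟩, e [1],
        by decide⟩
    · exact ⟨[3], ⟨le_rfl, .inl trivial⟩, (e [2]).trans (by rw [e2]), by decide⟩
  | i :: j :: M, ⟨h1, h2, h3, h4, h5⟩ =>
    obtain rfl : i = 3 := by omega
    obtain rfl : j = 2 := by omega
    match M, h5 with
    | [], _ =>
      exact ⟨[3, 1], ⟨le_rfl, .inl ⟨by omega, by omega, trivial⟩⟩, (e [2, 1]).trans (by rw [e2]),
        by decide⟩
    | k :: M, ⟨h6, h7, _⟩ => omega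

theorem phi_three_of_ff {X Y : Transf} (h : phi 3 * Y = alpha 4 * X) :
    phi 3 * Y = sT * (phi 5 * Y) := by
  have h5 : phi 5 = phi 3 * phi 4 := phi_add_three 2
  calc phi 3 * Y = alpha 4 * (phi 3 * Y) := by
        rw [h, alpha_four, mul_assoc, mul_assoc, fT_cube']
    _ = sT * (phi 5 * Y) := by
        rw [h5, phi_four, phi_three, alpha_four]
        simp only [mul_assoc]
        rw [sT_mul_cancel]

theorem Tail.adm_three {M : List ℕ} (hM : Tail 2 4 M) : Uni 1 3 (3 :: pr M) :=
  ⟨le_rfl, hM.imp (fun h => h.pr) fun h => h.pr (by omega)⟩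

theorem five_mul {M : List ℕ} (hM : Tail 2 4 M) :
    ∃ K, Uni 1 3 K ∧ phi 5 * phiProd (pr M) = phiProd K ∧ wt K ≤ 32 + wt M := by
  have h5 : ∀ {M}, Tail 2 5 M →
      ∃ K, Uni 1 3 K ∧ phi 5 * phiProd (pr M) = phiProd K ∧ wt K ≤ 32 + wt M := fun {M} h =>
    ⟨mrg 5 M, h.uni_mrg.mono (by omega), (phiProd_mrg (by omega) M).symm,
      (wt_mrg_le (h.one_le (by omega))).1⟩
  rcases hM with h | h
  · exact h5 (.inl (h.mono (by omega)))
  · match M, h with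
    | i :: M, ⟨h1, h2⟩ =>
      rcases Nat.eq_or_lt_of_le h1 with h6 | h7
      · obtain rfl : i = 6 := h6.symm
        have hT : Tail 2 6 M := h2
        refine ⟨3 :: mrg 6 M, ⟨le_rfl, .inr (hT.uni_mrg.mono (by omega))⟩, ?_, ?_⟩
        · rw [phiProd_cons, phiProd_mrg (by omega), phiProd_pr_cons, ← mul_assoc, ← mul_assoc]
          exact congrArg (· * _) (phi_mul_self 2)
        · have := (wt_mrg_le (k := 6) (hT.one_le (by omega))).1
          rw [wt_cons, wt_cons]
          omega
      · exact h5 (.inr ⟨h7, h2⟩)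

theorem Distinct.four_four {n : ℕ} {L M : List ℕ} (ih : Distinct n)
    (hL : Tail 2 4 L) (hM : Tail 2 4 M) (hw : wt (4 :: L) + wt (4 :: M) ≤ n)
    (h0 : alpha 4 * phiProd (pr L) = phi (4 - 1) * phiProd (pr M))
    (h1 : phi (4 - 1) * phiProd (pr L) = alpha 4 * phiProd (pr M)) : False := by
  have large : ∀ {L M : List ℕ}, Tail 2 4 M → wt (4 :: L) + wt (4 :: M) ≤ n →
      alpha 4 * phiProd (pr L) = phi (4 - 1) * phiProd (pr M) → wt M ≤ wt L → 64 ≤ wt L →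
      False := by
    intro L M hM hw h hle hlarge
    obtain ⟨K, hK, e, hwK⟩ := five_mul hM
    have h := phi_three_of_ff h.symm
    rw [e, ← phiProd_cons] at h
    refine (ih _ _ (.inr hM.adm_three) (.inr hK) ?_).2 h
    have := hM.wt_pr (by omega)
    rw [wt_cons] at hw ⊢
    rw [wt_cons] at hw
    omega
  have small : ∀ {L : List ℕ}, Tail 2 4 L → wt L < 64 → Dec 2 4 L := by
    intro L hL hlt
    rcases hL with h | h
    · exact h
    · match L, h with
      | i :: L, ⟨h1, _⟩ =>
        have := Nat.pow_le_pow_right two_pos h1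
        rw [wt_cons] at hlt
        omega
  rcases Nat.lt_or_ge (wt L) 64 with hl | hl <;> rcases Nat.lt_or_ge (wt M) 64 with hm | hm
  · obtain ⟨K, hK, e, hwK⟩ := ff_small (small hM hm)
    rw [e] at h1
    change phi 3 * _ = _ at h1
    rw [← phiProd_cons] at h1
    refine (ih _ _ (.inr hL.adm_three) (.inr hK) ?_).2 h1
    have := hL.wt_pr (by omega)
    rw [wt_cons] at hw ⊢
    rw [wt_cons] at hw
    omega
  · exact large hL (by omega) h1.symm (by omega) hm
  · exact large hM hw h0 (by omega) hl
  · rcases Nat.le_total (wt L) (wt M) with hle | hle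
    · exact large hL (by omega) h1.symm hle hm
    · exact large hM hw h0 hle hl

theorem Distinct.twisted {n i j : ℕ} {L M : List ℕ} (ih : Distinct n) (hi : 3 ≤ i) (hj : 3 ≤ j)
    (hL : Tail 2 i L) (hM : Tail 2 j M) (hw : wt (i :: L) + wt (j :: M) ≤ n)
    (h0 : alpha i * phiProd (pr L) = phi (j - 1) * phiProd (pr M))
    (h1 : phi (i - 1) * phiProd (pr L) = alpha j * phiProd (pr M)) : False := by
  rcases Nat.eq_or_lt_of_le hi with rfl | hi4 <;> rcases Nat.eq_or_lt_of_le hj with rfl | hj4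
  · exact ih.three_three hL hM hw h0 h1
  · exact ih.three_left hj4 hL hM hw h0
  · exact ih.three_left hi4 hM hL (by omega) h1.symm
  · rcases Nat.eq_or_lt_of_le hi4 with rfl | hi5 <;> rcases Nat.eq_or_lt_of_le hj4 with rfl | hj5
    · exact ih.four_four hL hM hw h0 h1
    · have := (ih.eq_five le_rfl hj5 hL hM hw h1).1
      omega
    · have := (ih.eq_five le_rfl hi5 hM hL (by rwa [add_comm]) h0.symm).1
      omega
    · obtain ⟨hi', h2⟩ := ih.eq_five hi4 hj5 hL hM hw h1
      obtain ⟨hj', h3⟩ := ih.eq_five hj4 hi5 hM hL (by omega) h0.symm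
      obtain ⟨M', rfl, e⟩ := h2 hj'
      obtain ⟨L', rfl, e'⟩ := h3 hi'
      have e := congrArg List.length e
      have e' := congrArg List.length e'
      simp only [List.length_map, List.length_cons] at e e'
      omega

theorem Dec.strip {m : ℕ} {J : List ℕ} (h : Dec 1 m J) :
    Dec 2 m J ∨ ∃ J', J = J' ++ [1] ∧ Dec 2 m J' := by
  induction J generalizing m with
  | nil => exact .inl trivial
  | cons i J ih =>
    obtain ⟨h1, h2, h3⟩ := h
    rcases Nat.eq_or_lt_of_le h1 with rfl | hi
    · match J, h3 with
      | [], _ => exact .inr ⟨[], rfl, trivial⟩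
      | j :: J, ⟨h4, h5, _⟩ => omega
    · rcases ih h3 with h | ⟨J', rfl, h⟩
      · exact .inl ⟨hi, h2, h⟩
      · exact .inr ⟨i :: J', rfl, hi, h2, h⟩

theorem Uni.strip {k : ℕ} {I : List ℕ} (h : Uni 1 k I) :
    Uni 2 k I ∨ ∃ I', I = I' ++ [1] ∧ Uni 2 k I' := by
  induction I generalizing k with
  | nil => exact h.elim
  | cons i I ih =>
    obtain ⟨h1, h2 | h2⟩ := h
    · rcases h2.strip with h | ⟨J, rfl, h⟩
      · exact .inl ⟨h1, .inl h⟩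
      · exact .inr ⟨i :: J, rfl, h1, .inl h⟩
    · rcases ih h2 with h | ⟨J, rfl, h⟩
      · exact .inl ⟨h1, .inr h⟩
      · exact .inr ⟨i :: J, rfl, h1, .inr h⟩

theorem Uni.sec {k : ℕ} {I : List ℕ} (hk : 2 ≤ k) (h : Uni 2 k I) :
    ∃ a b, Sec (phiProd I) a b := by
  match I, h with
  | i :: L, ⟨h1, h2⟩ =>
    have h2 : Tail 2 i L := h2
    exact ⟨_, _, sec_phiProd (hk.trans h1) (h2.le (by omega))⟩

theorem even_app_mul_sT {g : Transf} {x : ℤ} (h : Odd (app x g)) : Even (app x (g * sT)) := by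
  rw [app_mul, app_sT, sMap, if_pos h]
  exact h.sub_odd odd_one

theorem Uni.parity {k : ℕ} {I : List ℕ} (hk : 2 ≤ k) (h : Uni 1 k I) :
    (∀ x, Odd (app x (phiProd I))) ∨ ∀ x, Even (app x (phiProd I)) := by
  rcases h.strip with h' | ⟨I', rfl, h'⟩ <;> obtain ⟨a, b, hs⟩ := h'.sec hk
  · exact .inl hs.odd
  · right
    intro x
    rw [phiProd_append, phiProd_singleton, phi_one]
    exact even_app_mul_sT (hs.odd x)

theorem Uni.phiProd_ne_one {k : ℕ} {I : List ℕ} (hk : 2 ≤ k) (h : Uni 1 k I) :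
    phiProd I ≠ 1 ∧ phiProd I ≠ sT := by
  have e0 : app 0 sT = 1 := by rw [app_sT, sMap, if_neg (by decide)]; rfl
  have e1 : app 1 sT = 0 := by rw [app_sT, sMap, if_pos (by decide)]; rfl
  constructor <;> intro e <;> rcases h.parity hk with h | h <;> rw [e] at h
  · exact absurd (h 0) (by change ¬ Odd (0 : ℤ); decide)
  · exact absurd (h 1) (by change ¬ Even (1 : ℤ); decide)
  · exact absurd (h 1) (by rw [e1]; decide)
  · exact absurd (h 0) (by rw [e0]; decide)

theorem Distinct.step {n : ℕ} {I J : List ℕ} (ih : Distinct n) (hI : Uni 2 3 I) (hJ : Uni 2 3 J)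
    (hw : wt I + wt J ≤ n) : (phiProd I = phiProd J → I = J) ∧ phiProd I ≠ sT * phiProd J := by
  match I, J, hI, hJ with
  | i :: L, j :: M, ⟨hi, hL⟩, ⟨hj, hM⟩ =>
    have hL : Tail 2 i L := hL
    have hM : Tail 2 j M := hM
    have s1 := sec_phiProd (i := i) (by omega) (hL.le (by omega))
    have s2 := sec_phiProd (i := j) (by omega) (hM.le (by omega))
    constructor <;> intro h <;> rw [h] at s1
    · exact ih.same hi hj hL hM hw (s1.inj s2).2
    · obtain ⟨h0, h1⟩ := s1.inj s2.sT_mul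
      exact ih.twisted hi hj hL hM hw h0 h1

theorem distinct (n : ℕ) : Distinct n := by
  induction n with
  | zero => intro I J _ _ h; omega
  | succ n ih =>
    intro I J hI hJ hw
    rcases hI with rfl | hI <;> rcases hJ with rfl | hJ
    · refine ⟨fun _ => rfl, ?_⟩
      rw [phiProd_nil, mul_one]
      intro h
      have h0 : app 0 1 = app 0 sT := by rw [h]
      rw [app_sT, sMap, if_neg (by decide)] at h0
      exact absurd h0 (by change (0 : ℤ) ≠ _; decide)
    · obtain ⟨h1, h2⟩ := hJ.phiProd_ne_one (by omega)
      refine ⟨fun h => (h1 h.symm).elim, fun h => h2 ?_⟩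
      rw [← sT_mul_cancel (phiProd J), ← h, phiProd_nil, mul_one]
    · obtain ⟨h1, h2⟩ := hI.phiProd_ne_one (by omega)
      exact ⟨fun h => (h1 h).elim, fun h => h2 (by rw [h, phiProd_nil, mul_one])⟩
    · have e : ∀ K, phiProd (K ++ [1]) = phiProd K * sT := fun K => by
        rw [phiProd_append, phiProd_singleton, phi_one]
      have opp : ∀ {K : List ℕ} {g : Transf}, Uni 2 3 K → (∃ a b, Sec g a b) →
          phiProd (K ++ [1]) ≠ g := by
        rintro K g hK ⟨a, b, hg⟩ h
        obtain ⟨c, d, hs⟩ := hK.sec (by omega)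
        have h1 := even_app_mul_sT (hs.odd 0)
        rw [← e, h] at h1
        exact Int.not_even_iff_odd.2 (hg.odd 0) h1
      rcases hI.strip with hI' | ⟨I, rfl, hI'⟩ <;> rcases hJ.strip with hJ' | ⟨J, rfl, hJ'⟩
      · exact ih.step hI' hJ' (by omega)
      · obtain ⟨a, b, hs⟩ := hI'.sec (by omega)
        refine ⟨fun h => (opp hJ' ⟨a, b, hs⟩ h.symm).elim, fun h => ?_⟩
        refine opp hJ' ⟨b, a, hs.sT_mul⟩ ?_
        rw [h, sT_mul_cancel]
      · obtain ⟨a, b, hs⟩ := hJ'.sec (by omega)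
        exact ⟨fun h => (opp hI' ⟨a, b, hs⟩ h).elim, opp hI' ⟨b, a, hs.sT_mul⟩⟩
      · rw [wt_append, wt_append] at hw
        obtain ⟨h1, h2⟩ := ih.step hI' hJ' (by omega)
        rw [e, e]
        refine ⟨fun h => by rw [h1 (mul_sT_right_inj h)], fun h => h2 (mul_sT_right_inj ?_)⟩
        rw [h, mul_assoc]

theorem phiProd_injective {I J : List ℕ} (hI : Adm I) (hJ : Adm J) (h : phiProd I = phiProd J) :
    I = J := (distinct _ I J hI hJ (Nat.lt_succ_self _)).1 h

theorem phiProd_ne_sT_mul {I J : List ℕ} (hI : Adm I) (hJ : Adm J) :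
    phiProd I ≠ sT * phiProd J := (distinct _ I J hI hJ (Nat.lt_succ_self _)).2

theorem Dec.of_isChain {M : ℕ} {b : List ℕ} (h : (M :: b).IsChain (fun i j => i > j))
    (h1 : ∀ i ∈ b, 1 ≤ i) : Dec 1 M b := by
  induction b generalizing M with
  | nil => trivial
  | cons i b ih =>
    rw [List.isChain_cons_cons] at h
    obtain ⟨h2, h3⟩ := List.forall_mem_cons.1 h1
    exact ⟨h2, h.1, ih h.2 h3⟩

theorem Uni.of_isChain {k : ℕ} {a b : List ℕ} {M : ℕ} (hk : ∀ i ∈ (a ++ M :: b).head?, k ≤ i)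
    (ha : (a ++ [M]).IsChain (fun i j => i + 1 < j))
    (hb : (M :: b).IsChain (fun i j => i > j)) (h1 : ∀ i ∈ a ++ M :: b, 1 ≤ i) :
    Uni 1 k (a ++ M :: b) := by
  induction a generalizing k with
  | nil => exact ⟨by simpa using hk, .inl (Dec.of_isChain hb (List.forall_mem_cons.1 h1).2)⟩
  | cons i a ih =>
    refine ⟨by simpa using hk, .inr (ih ?_ ?_ (List.forall_mem_cons.1 h1).2)⟩
    · cases a with
      | nil =>
        have : i + 1 < M := by simpa using ha
        intro x hx
        simp only [List.nil_append, List.head?_cons, Option.mem_some_iff] at hx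
        omega
      | cons j a =>
        have : i + 1 < j := (List.isChain_cons_cons.1 ha).1
        intro x hx
        simp only [List.cons_append, List.head?_cons, Option.mem_some_iff] at hx
        omega
    · exact ha.tail

theorem adm_of_isAdmissible {I : List ℕ} (h : IsAdmissible I) : Adm I := by
  rcases h with rfl | ⟨a, M, b, rfl, hk, ha, hb, h1⟩
  · exact .inl rfl
  · exact .inr (Uni.of_isChain hk ha hb h1)

theorem Dec.isChain {M : ℕ} {b : List ℕ} (h : Dec 1 M b) :
    (M :: b).IsChain (fun i j => i > j) := by
  induction b generalizing M with
  | nil => exact List.isChain_singleton _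
  | cons i b ih => exact List.isChain_cons_cons.2 ⟨h.2.1, ih h.2.2⟩

theorem Uni.exists_split {k : ℕ} {I : List ℕ} (h : Uni 1 k I) :
    ∃ (a : List ℕ) (M : ℕ) (b : List ℕ), I = a ++ M :: b ∧
      (∀ i ∈ I.head?, k ≤ i) ∧ (a ++ [M]).IsChain (fun i j => i + 1 < j) ∧
      (M :: b).IsChain (fun i j => i > j) := by
  induction I generalizing k with
  | nil => exact h.elim
  | cons i I ih =>
    obtain ⟨h1, h2 | h2⟩ := h
    · exact ⟨[], i, I, rfl, by simpa using h1, List.isChain_singleton _, h2.isChain⟩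
    · obtain ⟨a, M, b, rfl, hk, ha, hb⟩ := ih h2
      refine ⟨i :: a, M, b, rfl, by simpa using h1, ?_, hb⟩
      cases a with
      | nil =>
        have : i + 2 ≤ M := by simpa using hk
        exact List.isChain_cons_cons.2 ⟨by omega, ha⟩
      | cons j a =>
        have : i + 2 ≤ j := by simpa using hk
        exact List.isChain_cons_cons.2 ⟨by omega, ha⟩

theorem Adm.isAdmissible {I : List ℕ} (h : Adm I) : IsAdmissible I := by
  rcases h with rfl | h
  · exact .inl rfl
  · obtain ⟨a, M, b, e, hk, ha, hb⟩ := h.exists_split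
    exact .inr ⟨a, M, b, e, hk, ha, hb, h.le (by omega)⟩

theorem eval_nfWord_inj {ε ε' : Fin 2} {I I' : List ℕ} (hI : Adm I) (hI' : Adm I')
    (h : eval (nfWord ε I) = eval (nfWord ε' I')) : ε = ε' ∧ I = I' := by
  rw [← eval_redWord, ← eval_redWord] at h
  rcases Fin.exists_fin_two.1 ⟨ε, rfl⟩ with rfl | rfl <;>
    rcases Fin.exists_fin_two.1 ⟨ε', rfl⟩ with rfl | rfl <;>
    simp only [redWord_zero, redWord_one, eval_sCons, eval_fibWords] at h
  · exact ⟨rfl, phiProd_injective hI hI' h⟩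
  · exact (phiProd_ne_sT_mul hI hI' h).elim
  · exact (phiProd_ne_sT_mul hI' hI h.symm).elim
  · exact ⟨rfl, phiProd_injective hI hI' (sT_mul_left_inj h)⟩

theorem isUniqueMinimal_redWord {ε : Fin 2} {I : List ℕ} {g : Transf} (hI : Adm I)
    (hg : eval (nfWord ε I) = g) : IsUniqueMinimal (redWord ε I) g := by
  refine ⟨(eval_redWord ε I).trans hg, fun u hu hne => ?_⟩
  induction hn : u.length using Nat.strong_induction_on generalizing u with
  | _ n ih =>
    rcases good_word u with ⟨ε', I', hI', rfl⟩ | ⟨v, hv, hl⟩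
    · rw [eval_redWord] at hu
      obtain ⟨rfl, rfl⟩ := eval_nfWord_inj hI hI' (hg.trans hu.symm)
      exact (hne rfl).elim
    · rcases eq_or_ne v (redWord ε I) with rfl | hv'
      · omega
      · have := ih v.length (by omega) v (hv.trans hu) hv' rfl
        omega

theorem IsUniqueMinimal.norm_eq {w : List Letter} {g : Transf} (h : IsUniqueMinimal w g) :
    norm g = w.length := by
  refine IsLeast.csInf_eq ⟨⟨w, h.1, rfl⟩, ?_⟩
  rintro l ⟨u, hu, rfl⟩
  rcases eq_or_ne u w with rfl | hne
  · exact le_rfl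
  · exact (h.2 u hu hne).le

theorem exists_eval_eq {g : Transf} (hg : g ∈ F) : ∃ w, eval w = g := by
  induction hg using Subsemigroup.closure_induction with
  | mem x hx =>
    rcases hx with rfl | rfl
    · exact ⟨[Letter.s], eval_s⟩
    · exact ⟨[Letter.f], eval_f⟩
  | mul x y _ _ hx hy =>
    obtain ⟨u, rfl⟩ := hx
    obtain ⟨v, rfl⟩ := hy
    exact ⟨u ++ v, eval_append u v⟩

theorem exists_nfWord (w : List Letter) : ∃ ε I, Adm I ∧ eval (nfWord ε I) = eval w := by
  induction hn : w.length using Nat.strong_induction_on generalizing w with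
  | _ n ih =>
    rcases good_word w with ⟨ε, I, hI, rfl⟩ | ⟨v, hv, hl⟩
    · exact ⟨ε, I, hI, (eval_redWord ε I).symm⟩
    · obtain ⟨ε, I, hI, e⟩ := ih v.length (by omega) v rfl
      exact ⟨ε, I, hI, e.trans hv⟩

theorem length_fibWords (I : List ℕ) : (fibWords I).length = (I.map Nat.fib).sum := by
  rw [List.length_flatMap]
  congr 1
  exact List.map_congr_left fun i _ => length_fibWord i

theorem nfWord_one (I : List ℕ) : nfWord 1 I = Letter.s :: fibWords I := rfl

theorem redWord_one_even {i : ℕ} {J : List ℕ} (hi : Even i) (h0 : 0 < i) :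
    redWord 1 (i :: J) = nfWord 1 (i :: J) := by
  obtain ⟨w, hw⟩ := fibWord_even hi h0
  rw [redWord_one, nfWord_one, fibWords_cons, hw]
  rfl

theorem nfWord_one_odd {i : ℕ} {J : List ℕ} (hi : Odd i) :
    nfWord 1 (i :: J) = Letter.s :: Letter.s :: redWord 1 (i :: J) := by
  obtain ⟨w, hw⟩ := fibWord_odd hi
  rw [redWord_one, nfWord_one, fibWords_cons, hw]
  rfl

theorem length_nfWord (ε : Fin 2) (I : List ℕ) :
    ((nfWord ε I).length : ℤ) = (ε : ℕ) + (I.map fun i => (Nat.fib i : ℤ)).sum := by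
  have : (nfWord ε I).length = (ε : ℕ) + (fibWords I).length := by simp [nfWord]
  rw [this, length_fibWords, Nat.cast_add, Nat.cast_list_sum, List.map_map]
  rfl

end FibSemigroup

theorem mainTheorem2 (g : FibSemigroup.Transf) (hg : g ∈ FibSemigroup.F) :
    (∃! p : Fin 2 × List ℕ,
      FibSemigroup.IsAdmissible p.2 ∧ FibSemigroup.eval (FibSemigroup.nfWord p.1 p.2) = g) ∧
    ∀ (ε : Fin 2) (I : List ℕ), FibSemigroup.IsAdmissible I →
      FibSemigroup.eval (FibSemigroup.nfWord ε I) = g →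
      (I = [] → FibSemigroup.IsUniqueMinimal (FibSemigroup.nfWord ε I) g ∧
        FibSemigroup.norm g = (ε : ℕ)) ∧
      (∀ (i₁ : ℕ) (J : List ℕ), I = i₁ :: J →
        (Even i₁ → FibSemigroup.IsUniqueMinimal (FibSemigroup.nfWord ε I) g) ∧
        (Odd i₁ → ε = 0 → FibSemigroup.IsUniqueMinimal (FibSemigroup.nfWord ε I) g) ∧
        (Odd i₁ → ε = 1 → ∃ u : List FibSemigroup.Letter,
          FibSemigroup.nfWord ε I = FibSemigroup.Letter.s :: FibSemigroup.Letter.s :: u ∧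
          FibSemigroup.IsUniqueMinimal u g) ∧
        (FibSemigroup.norm g : ℤ) =
          (-1) ^ i₁ * ((ε : ℕ) : ℤ) + (I.map fun i => (Nat.fib i : ℤ)).sum) := by
  open FibSemigroup in
  constructor
  · obtain ⟨w, rfl⟩ := exists_eval_eq hg
    obtain ⟨ε, I, hI, e⟩ := exists_nfWord w
    refine ⟨(ε, I), ⟨hI.isAdmissible, e⟩, ?_⟩
    rintro ⟨ε', I'⟩ ⟨hI', e'⟩
    obtain ⟨rfl, rfl⟩ := eval_nfWord_inj (adm_of_isAdmissible hI') hI (e'.trans e.symm)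
    rfl
  · intro ε I hI e
    have hA := adm_of_isAdmissible hI
    have hmin := isUniqueMinimal_redWord hA e
    refine ⟨?_, ?_⟩
    · rintro rfl
      have hr : redWord ε [] = nfWord ε [] := by
        rcases Fin.exists_fin_two.1 ⟨ε, rfl⟩ with rfl | rfl <;> rfl
      rw [hr] at hmin
      refine ⟨hmin, ?_⟩
      rw [hmin.norm_eq]
      simp [nfWord]
    · rintro i J rfl
      have hi : 0 < i := by
        rcases hA with h | h
        · simp at h
        · exact lt_of_lt_of_le (by omega) h.1
      rcases Fin.exists_fin_two.1 ⟨ε, rfl⟩ with rfl | rfl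
      · have hmin : IsUniqueMinimal (nfWord 0 (i :: J)) g := hmin
        refine ⟨fun _ => hmin, fun _ _ => hmin, fun _ h => absurd h (by decide), ?_⟩
        rw [hmin.norm_eq, length_nfWord]
        simp
      · rcases Nat.even_or_odd i with h | h
        · rw [redWord_one_even h hi] at hmin
          refine ⟨fun _ => hmin, fun _ h => absurd h (by decide),
            fun h' => (Nat.not_even_iff_odd.2 h' h).elim, ?_⟩
          rw [hmin.norm_eq, length_nfWord, h.neg_one_pow, one_mul]
        · refine ⟨fun h' => (Nat.not_even_iff_odd.2 h h').elim, fun _ h => absurd h (by decide),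
            fun _ _ => ⟨_, nfWord_one_odd h, hmin⟩, ?_⟩
          have hl := length_nfWord 1 (i :: J)
          rw [nfWord_one_odd h, List.length_cons, List.length_cons] at hl
          rw [hmin.norm_eq, h.neg_one_pow]
          push_cast at hl ⊢
          simp only [Fin.val_one, Nat.cast_one] at hl ⊢
          linarith
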